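/- Let $m>0$. On $\mathbb R^4$ write $\langle x,p\rangle=x^0p^0-x^1p^1-x^2p^2-x^3p^3$ and let $$D_m(x)=\frac{1}{i(2\pi)^3}\int d^4p\,\epsilon(p^0)\,\delta(p^2-m^2)\,e^{i\langle p,x\rangle}\in\mathcal S'(\mathbb R^4)$$ be the Pauli–Jordan function, i.e. with $\omega(\mathbf p)=\sqrt{\mathbf p^2+m^2}$ and $\hat f(p)=\int f(x)e^{i\langle x,p\rangle}dx$, $(D_m,f)=\frac{1}{i(2\pi)^3}\int_{\mathbb R^3}\frac{d\mathbf p}{2\omega(\mathbf p)}\bigl(\hat f(\omega(\mathbf p),\mathbf p)-\hat f(-\omega(\mathbf p),\mathbf p)\bigr)$. Let $\kappa(x)=\bigl(\tfrac{x^0+x^3}{\sqrt2},x^1,x^2,\tfrac{x^0-x^3}{\sqrt2}\bigr)=(x^+,x_\bot,x^-)$ be the transformation to light-cone coordinates, $\widetilde D_m=D_m\circ\kappa^{-1}$, and $\tilde{\mathbf x}=(x_\bot,x^-)$. For $k=3,4$ let $\mathcal S_{\partial_-}(\mathbb R^k)=\bigcap_{j\ge0}\partial_{x^-}^j\mathcal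 S(\mathbb R^k)$ with the topology induced by $\mathcal S(\mathbb R^k)$, where $x^-$ is the last coordinate, and let $\mathcal S'_{\partial_-}(\mathbb R^k)$ be its dual. For $u\in\mathcal S'(\mathbb R^k)$ let $u^*\in\mathcal S'_{\partial_-}(\mathbb R^k)$ be the restriction of $u$ to $\mathcal S_{\partial_-}(\mathbb R^k)$. One says that $u\in\mathcal S'(\mathbb R^4)$ admits a tame restriction to $\{x^+=0\}$, equal to $u|^*_{x^+=0}:=u_0\in\mathcal S'_{\partial_-}(\mathbb R^3)$, if there are an open $\Omega\ni0$ in $\mathbb R$ and a family $(u_s)_{s\in\Omega}$ in $\mathcal S'_{\partial_-}(\mathbb R^3)$ such that $s\mapsto(u_s,g)$ is $C^\infty$ on $\Omega$ and $(u^*,f\otimes g)=\int_\Omega(u_s,g)f(s)\,ds$ for all $f\in\mathcal D(\Omega)$ and $g\in\mathcal S_{\partial_-}(\mathbb R^3)$. (1) $\widetilde D_m$ admits a tame restriction to $\{x^+=0\}$, it is unique, and $$\widetilde D_m|^*_{x^+=0}=\tfrac14\,\bigl(\delta(x_\bot)\otimes\epsilon(x^-)\bigr)\quad\text{in }\mathcal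 S'_{\partial_-}(\mathbb R^3),$$ where $\epsilon$ is the sign function and the right-hand side is the functional $g\mapsto\frac14\int_{\mathbb R}\epsilon(t)\,g(0,0,t)\,dt$. (2) This reproduces the light-cone equal-time commutator relation. Let $\phi$ be a real scalar free field of mass $m$: a hermitian operator-valued tempered distribution on a common invariant domain (a complex inner product space $V$), which solves $(\Box+m^2)\phi=0$ and obeys $[\phi(x),\phi(y)]=-iD_m(x-y)$. Let $\widetilde\phi=\phi\circ\kappa^{-1}$, and let $\widetilde\phi(0,\cdot)$ be a tame restriction of $\widetilde\phi$ to $\{x^+=0\}$: a member, at $s=0$, of a family of linear maps $\widetilde\phi(s,\cdot):\mathcal S_{\partial_-}(\mathbb R^3)\to\operatorname{End}(V)$, $s\in\Omega\ni 0$, whose matrix elements give the tame restrictions of the matrix elements of $\widetilde\phi$ in the above sense. Then, as an identity smeared with arbitrary $g_1(\tilde{\mathbf x}),g_2(\tilde{\mathbf y})\in\mathcal S_{\partial_-}(\mathbb R^3)$, $$[\widetilde\phi(0,\tilde{\mathbf x}),\widetilde\phi(0,\tilde{\mathbf y})]=\frac{1}{4i}\,\bigl(\delta(x_\bot-y_\bot)\otimes\epsilon(x^--y^-)\bigr).$$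 -/

import Mathlib

open MeasureTheory Set
open scoped SchwartzMap LineDeriv FourierTransform ContDiff

noncomputable section

namespace LightCone

/-- Space-time `ℝ^{1+3}`: coordinates `(x⁰, x¹, x², x³)`, respectively `(x⁺, x¹, x², x⁻)`. -/
abbrev E4 : Type := EuclideanSpace ℝ (Fin 4)

/-- Space `ℝ³`: coordinates `(x¹, x², x³)`, respectively `(x¹, x², x⁻)`. -/
abbrev E3 : Type := EuclideanSpace ℝ (Fin 3)

/-! ### Minkowski Fourier transform and the Pauli-Jordan function -/

/-- The Minkowski bilinear form `x⁰y⁰ - x¹y¹ - x²y² - x³y³`. -/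
def mink (x y : E4) : ℝ := x 0 * y 0 - x 1 * y 1 - x 2 * y 2 - x 3 * y 3

/-- The linear isomorphism `p ↦ (-p⁰, p¹, p², p³) / (2π)`, which relates the Minkowski Fourier
transform to Mathlib's Fourier transform. -/
def minkScale : E4 ≃L[ℝ] E4 :=
  LinearEquiv.toContinuousLinearEquiv
    { toFun := fun p =>
        !₂[-(p 0) / (2 * Real.pi), p 1 / (2 * Real.pi), p 2 / (2 * Real.pi), p 3 / (2 * Real.pi)]
      invFun := fun p =>
        !₂[-(2 * Real.pi * p 0), 2 * Real.pi * p 1, 2 * Real.pi * p 2, 2 * Real.pi * p 3]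
      map_add' := by
        intro x y; ext i; fin_cases i <;> simp <;> ring
      map_smul' := by
        intro c x; ext i; fin_cases i <;> simp <;> ring
      left_inv := by
        intro x; ext i
        have := Real.pi_ne_zero
        fin_cases i <;> simp [mul_div_cancel₀]
      right_inv := by
        intro x; ext i
        have := Real.pi_ne_zero
        fin_cases i <;> simp [mul_div_cancel_left₀] }

/-- The Minkowski Fourier transform `f ↦ (p ↦ ∫ f(x) exp(i⟨x, p⟩) dx)` on Schwartz functions
(see `minkFourier_apply`). -/
def minkFourier : 𝓢(E4, ℂ) →L[ℂ] 𝓢(E4, ℂ) :=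
  (SchwartzMap.compCLMOfContinuousLinearEquiv ℂ minkScale).comp
    (FourierTransform.fourierCLM ℂ 𝓢(E4, ℂ))

theorem minkFourier_apply (f : 𝓢(E4, ℂ)) (p : E4) :
    minkFourier f p = ∫ x : E4, f x * Complex.exp (Complex.I * (mink x p : ℝ)) := by
  have h : minkFourier f p = 𝓕 (f : E4 → ℂ) (minkScale p) := rfl
  rw [h, Real.fourier_eq']
  congr 1
  ext x
  rw [smul_eq_mul, mul_comm]
  congr 2
  have : (-2 * Real.pi * inner ℝ x (minkScale p) : ℝ) = mink x p := by
    have := Real.pi_ne_zero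
    simp only [PiLp.inner_apply, Fin.sum_univ_four, minkScale, mink]
    simp
    field_simp
    ring
  rw [this, mul_comm]

/-- The energy `ω(p) = √(p² + m²)`. -/
def omega (m : ℝ) (p : E3) : ℝ := Real.sqrt (‖p‖ ^ 2 + m ^ 2)

/-- The parametrisation `p ↦ (s ω(p), p)` of the sheet of the mass shell `p² = m²` on which the
energy has the sign `s = ±1`. -/
def shell (m s : ℝ) (p : E3) : E4 := !₂[s * omega m p, p 0, p 1, p 2]

theorem norm_le_omega (m : ℝ) (p : E3) : ‖p‖ ≤ omega m p :=
  Real.le_sqrt_of_sq_le (by nlinarith [sq_nonneg m])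

theorem norm_le_norm_shell (m s : ℝ) (p : E3) : ‖p‖ ≤ ‖shell m s p‖ := by
  rw [EuclideanSpace.norm_eq, EuclideanSpace.norm_eq]
  apply Real.sqrt_le_sqrt
  simp only [Fin.sum_univ_four, Fin.sum_univ_three, shell]
  simp
  positivity

theorem continuous_omega (m : ℝ) : Continuous (omega m) := by
  unfold omega
  fun_prop

theorem continuous_shell (m s : ℝ) : Continuous (shell m s) := by
  have := continuous_omega m
  unfold shell
  apply (PiLp.continuous_toLp 2 _).comp
  refine continuous_pi fun i => ?_
  fin_cases i <;> simp <;> fun_prop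

theorem integrable_weight :
    Integrable (fun p : E3 => ((1 + ‖p‖) ^ 5)⁻¹ * (2 * ‖p‖)⁻¹) := by
  have h := (integrable_fun_norm_addHaar (E := E3) volume
    (f := fun y : ℝ => ((1 + y) ^ 5)⁻¹ * (2 * y)⁻¹)).2
  apply h
  have hd : Module.finrank ℝ E3 = 3 := by simp
  rw [hd]
  have hg : IntegrableOn (fun y : ℝ => (1 + ‖y‖) ^ (-(2 : ℝ))) (Ioi 0) :=
    (integrable_one_add_norm (E := ℝ) (μ := volume) (r := 2) (by simp)).integrableOn
  refine Integrable.mono' hg ?_ ?_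
  · apply Measurable.aestronglyMeasurable
    fun_prop
  · filter_upwards [self_mem_ae_restrict (measurableSet_Ioi : MeasurableSet (Ioi (0 : ℝ)))] with y hy
    have hy : 0 < y := hy
    rw [Real.norm_of_nonneg (by positivity), Real.norm_of_nonneg hy.le,
      Real.rpow_neg (by positivity)]
    norm_num
    rw [show y ^ 2 * (((1 + y) ^ 5)⁻¹ * (y⁻¹ * (1 / 2))) = (y / 2) * ((1 + y) ^ 5)⁻¹ by field_simp]
    rw [← div_eq_mul_inv, ← one_div, div_le_div_iff₀ (by positivity) (by positivity)]
    have : (1 + y) ^ 5 = (1 + y) ^ 2 * (1 + y) ^ 3 := by ring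
    rw [this]
    have h3 : y / 2 ≤ (1 + y) ^ 3 := by nlinarith [pow_pos hy 2, pow_pos hy 3]
    nlinarith [sq_nonneg (1 + y)]

theorem shell_bound (f : 𝓢(E4, ℂ)) (m s : ℝ) {p : E3} (hp : p ≠ 0) :
    ‖f (shell m s p) / (2 * (omega m p : ℂ))‖ ≤
      (2 ^ 5 * (Finset.Iic (5, 0)).sup (schwartzSeminormFamily ℂ E4 ℂ) f) *
        (((1 + ‖p‖) ^ 5)⁻¹ * (2 * ‖p‖)⁻¹) := by
  have h1 := SchwartzMap.one_add_le_sup_seminorm_apply (𝕜 := ℂ) (m := (5, 0)) (k := 5) (n := 0)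
    le_rfl le_rfl f (shell m s p)
  rw [norm_iteratedFDeriv_zero] at h1
  have h2 : (1 + ‖p‖) ^ 5 * ‖f (shell m s p)‖ ≤
      2 ^ 5 * (Finset.Iic (5, 0)).sup (schwartzSeminormFamily ℂ E4 ℂ) f := by
    refine le_trans ?_ h1
    gcongr
    exact norm_le_norm_shell m s p
  have h0 : 0 < ‖p‖ := norm_pos_iff.2 hp
  have hω : ‖p‖ ≤ omega m p := norm_le_omega m p
  have hω0 : 0 < omega m p := h0.trans_le hω
  have h5 : 0 < (1 + ‖p‖) ^ 5 := by positivity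
  have h3 : ‖f (shell m s p)‖ ≤
      (2 ^ 5 * (Finset.Iic (5, 0)).sup (schwartzSeminormFamily ℂ E4 ℂ) f) *
        ((1 + ‖p‖) ^ 5)⁻¹ := by
    rw [← div_eq_mul_inv, le_div_iff₀ h5, mul_comm]
    exact h2
  have h4 : ‖(2 * (omega m p : ℂ))‖ = 2 * omega m p := by
    rw [norm_mul, Complex.norm_real, Real.norm_of_nonneg hω0.le]
    norm_num
  rw [norm_div, h4, div_eq_mul_inv, ← mul_assoc]
  refine mul_le_mul h3 ?_ (by positivity) ((norm_nonneg _).trans h3)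
  gcongr

theorem ae_ne_zero : ∀ᵐ p : E3, p ≠ 0 := by
  simp [ae_iff]

theorem integrable_shell (f : 𝓢(E4, ℂ)) (m s : ℝ) :
    Integrable (fun p : E3 => f (shell m s p) / (2 * (omega m p : ℂ))) := by
  refine Integrable.mono' (integrable_weight.const_mul
    (2 ^ 5 * (Finset.Iic (5, 0)).sup (schwartzSeminormFamily ℂ E4 ℂ) f)) ?_ ?_
  · apply Measurable.aestronglyMeasurable
    have h1 : Measurable (fun p => f (shell m s p)) :=
      (f.continuous.comp (continuous_shell m s)).measurable
    have h2 : Measurable (omega m) := (continuous_omega m).measurable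
    exact h1.div (by fun_prop)
  · filter_upwards [ae_ne_zero] with p hp
    exact shell_bound f m s hp

/-- The tempered distribution `δ_±(p² - m²)` (with `s = ±1`): it maps a Schwartz function `f` on
momentum space to `∫ f(± ω(p), p) / (2 ω(p)) dp`. -/
def deltaShell (m s : ℝ) : 𝓢(E4, ℂ) →L[ℂ] ℂ :=
  SchwartzMap.mkCLMtoNormedSpace
    (fun f => ∫ p : E3, f (shell m s p) / (2 * (omega m p : ℂ)))
    (by
      intro f g
      rw [← integral_add (integrable_shell f m s) (integrable_shell g m s)]
      congr 1
      ext p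
      simp [add_div])
    (by
      intro a f
      rw [smul_eq_mul, RingHom.id_apply, ← integral_const_mul]
      congr 1
      ext p
      simp [mul_div_assoc])
    (by
      refine ⟨Finset.Iic (5, 0), 2 ^ 5 * ∫ p : E3, ((1 + ‖p‖) ^ 5)⁻¹ * (2 * ‖p‖)⁻¹,
        mul_nonneg (by positivity) (integral_nonneg fun p => by positivity), fun f => ?_⟩
      have h := norm_integral_le_of_norm_le (integrable_weight.const_mul
        (2 ^ 5 * (Finset.Iic (5, 0)).sup (schwartzSeminormFamily ℂ E4 ℂ) f))
        (ae_ne_zero.mono fun p hp => shell_bound f m s hp)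
      rw [integral_const_mul] at h
      refine h.trans (le_of_eq ?_)
      ring)

/-- The Pauli-Jordan function
`D_m(x) = (1 / (i (2π)³)) ∫ ε(p⁰) δ(p² - m²) exp(i⟨p, x⟩) d⁴p` as a tempered distribution, i.e. the
Minkowski Fourier transform of `(1 / (i (2π)³)) (δ₊(p² - m²) - δ₋(p² - m²))`. -/
def pauliJordan (m : ℝ) : 𝓢'(E4, ℂ) :=
  ContinuousLinearMap.toPointwiseConvergenceCLM _ _ _ _
    ((1 / (Complex.I * (2 * Real.pi) ^ 3) : ℂ) •
      (deltaShell m 1 - deltaShell m (-1)).comp minkFourier)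

/-! ### Light-cone coordinates -/

/-- The linear map `κ(x) = ((x⁰ + x³)/√2, x¹, x², (x⁰ - x³)/√2)`. It is its own inverse and a
Euclidean isometry, so it preserves Lebesgue measure. -/
def kappa : E4 ≃ₗᵢ[ℝ] E4 where
  toFun x := !₂[(x 0 + x 3) / √2, x 1, x 2, (x 0 - x 3) / √2]
  invFun x := !₂[(x 0 + x 3) / √2, x 1, x 2, (x 0 - x 3) / √2]
  map_add' x y := by ext i; fin_cases i <;> simp <;> ring
  map_smul' c x := by ext i; fin_cases i <;> simp <;> ring
  left_inv x := by
    ext i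
    have h : √2 ^ 2 = (2 : ℝ) := Real.sq_sqrt (by norm_num)
    fin_cases i <;> simp <;> field_simp <;> rw [h] <;> ring
  right_inv x := by
    ext i
    have h : √2 ^ 2 = (2 : ℝ) := Real.sq_sqrt (by norm_num)
    fin_cases i <;> simp <;> field_simp <;> rw [h] <;> ring
  norm_map' x := by
    rw [EuclideanSpace.norm_eq, EuclideanSpace.norm_eq]
    congr 1
    simp [Fin.sum_univ_four, div_pow]
    ring

/-- Composition `F ↦ F ∘ κ` on Schwartz functions. -/
def compKappa : 𝓢(E4, ℂ) →L[ℂ] 𝓢(E4, ℂ) :=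
  SchwartzMap.compCLMOfContinuousLinearEquiv ℂ kappa.toContinuousLinearEquiv

/-- The transform `D̃_m = D_m ∘ κ⁻¹`, i.e. `(D̃_m, F) = (D_m, F ∘ κ)`, where `|det κ| = 1`. -/
def pauliJordanLC (m : ℝ) : 𝓢'(E4, ℂ) :=
  PointwiseConvergenceCLM.precomp ℂ compKappa (pauliJordan m)

/-! ### Tame generalized functions -/

/-- The space `⋂_k ∂_i^k 𝓢(ℝ^ι)` with the subspace topology. For `ι = Fin 4`, `i = 3` and for
`ι = Fin 3`, `i = 2` the derivative `∂_i` is `∂_{x⁻}`, and these are the spaces `𝓢_{∂₋}`. -/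
def tameSpace {ι : Type} [Fintype ι] [DecidableEq ι] (i : ι) :
    Submodule ℂ 𝓢(EuclideanSpace ℝ ι, ℂ) :=
  ⨅ k : ℕ, LinearMap.range
    ((LineDeriv.lineDerivOpCLM ℂ 𝓢(EuclideanSpace ℝ ι, ℂ)
      (EuclideanSpace.single i (1 : ℝ)) :
        𝓢(EuclideanSpace ℝ ι, ℂ) →ₗ[ℂ] 𝓢(EuclideanSpace ℝ ι, ℂ)) ^ k)

/-- Tame generalized functions: the dual `𝓢'_{∂₋}` of `𝓢_{∂₋}`. -/
abbrev TameDual {ι : Type} [Fintype ι] [DecidableEq ι] (i : ι) : Type := tameSpace i →L[ℂ] ℂ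

/-- The relaxation `u*` of a tempered distribution `u`: its restriction to `𝓢_{∂₋}`. -/
def relax {ι : Type} [Fintype ι] [DecidableEq ι] (i : ι) (u : 𝓢'(EuclideanSpace ℝ ι, ℂ)) :
    TameDual i where
  toFun g := u g
  map_add' g h := by simp
  map_smul' c g := by simp
  cont := (map_continuous u).comp continuous_subtype_val

/-- The spatial part `(x⁺, x¹, x², x⁻) ↦ (x¹, x², x⁻)`. -/
def spatial : E4 →L[ℝ] E3 :=
  LinearMap.toContinuousLinearMap
    { toFun := fun x => !₂[x 1, x 2, x 3]
      map_add' := by intro x y; ext i; fin_cases i <;> simp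
      map_smul' := by intro c x; ext i; fin_cases i <;> simp }

/-- The time coordinate `(x⁺, x¹, x², x⁻) ↦ x⁺`. -/
def time : E4 →L[ℝ] ℝ := EuclideanSpace.proj 0

theorem norm_time_le (x : E4) : ‖time x‖ ≤ ‖x‖ := PiLp.norm_apply_le x 0

theorem norm_spatial_le (x : E4) : ‖spatial x‖ ≤ ‖x‖ := by
  rw [EuclideanSpace.norm_eq, EuclideanSpace.norm_eq]
  apply Real.sqrt_le_sqrt
  simp only [Fin.sum_univ_four, Fin.sum_univ_three, spatial]
  simp
  positivity

theorem norm_le_time_add_spatial (x : E4) : ‖x‖ ≤ ‖time x‖ + ‖spatial x‖ := by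
  have h : ‖x‖ ^ 2 = ‖time x‖ ^ 2 + ‖spatial x‖ ^ 2 := by
    rw [EuclideanSpace.norm_sq_eq, EuclideanSpace.norm_sq_eq]
    simp [Fin.sum_univ_four, Fin.sum_univ_three, spatial, time]
    ring
  nlinarith [norm_nonneg x, norm_nonneg (time x), norm_nonneg (spatial x),
    mul_nonneg (norm_nonneg (time x)) (norm_nonneg (spatial x))]

theorem norm_iteratedFDeriv_comp_le {F : Type*} [NormedAddCommGroup F] [NormedSpace ℝ F]
    (L : E4 →L[ℝ] F) (hL : ‖L‖ ≤ 1) (f : 𝓢(F, ℂ)) (n : ℕ) (x : E4) :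
    ‖iteratedFDeriv ℝ n (fun y => f (L y)) x‖ ≤ ‖iteratedFDeriv ℝ n f (L x)‖ := by
  have h := L.iteratedFDeriv_comp_right (f.smooth n) x (i := n) le_rfl
  have h' : iteratedFDeriv ℝ n (fun y => f (L y)) x =
      (iteratedFDeriv ℝ n f (L x)).compContinuousLinearMap fun _ => L := h
  rw [h']
  refine (ContinuousMultilinearMap.norm_compContinuousLinearMap_le _ _).trans ?_
  refine mul_le_of_le_one_right (norm_nonneg _) ?_
  simp only [Finset.prod_const]
  exact pow_le_one₀ (norm_nonneg _) hL

/-- The tensor product `(f ⊗ g)(x⁺, x¹, x², x⁻) = f(x⁺) g(x¹, x², x⁻)`. -/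
def tensor (f : 𝓢(ℝ, ℂ)) (g : 𝓢(E3, ℂ)) : 𝓢(E4, ℂ) where
  toFun x := f (time x) * g (spatial x)
  smooth' := ((f.smooth ⊤).comp time.contDiff).mul ((g.smooth ⊤).comp spatial.contDiff)
  decay' := by
    intro k n
    have ht : ‖time‖ ≤ 1 :=
      ContinuousLinearMap.opNorm_le_bound _ zero_le_one fun x => by
        rw [one_mul]; exact norm_time_le x
    have hs : ‖spatial‖ ≤ 1 :=
      ContinuousLinearMap.opNorm_le_bound _ zero_le_one fun x => by
        rw [one_mul]; exact norm_spatial_le x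
    refine ⟨2 ^ (k - 1) * ∑ i ∈ Finset.range (n + 1), (n.choose i : ℝ) *
      (SchwartzMap.seminorm ℝ k i f * SchwartzMap.seminorm ℝ 0 (n - i) g +
        SchwartzMap.seminorm ℝ 0 i f * SchwartzMap.seminorm ℝ k (n - i) g), fun x => ?_⟩
    have h1 := norm_iteratedFDeriv_mul_le (𝕜 := ℝ) (n := n) (N := ∞)
      (f := fun y => f (time y)) (g := fun y => g (spatial y))
      ((f.smooth ⊤).comp time.contDiff) ((g.smooth ⊤).comp spatial.contDiff) x
      (mod_cast le_top)
    have h2 : ‖x‖ ^ k ≤ 2 ^ (k - 1) * (‖time x‖ ^ k + ‖spatial x‖ ^ k) :=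
      (pow_le_pow_left₀ (norm_nonneg x) (norm_le_time_add_spatial x) k).trans
        (add_pow_le (norm_nonneg _) (norm_nonneg _) k)
    refine (mul_le_mul h2 h1 (norm_nonneg _) (by positivity)).trans ?_
    rw [mul_assoc]
    gcongr
    rw [Finset.mul_sum]
    refine Finset.sum_le_sum fun i _ => ?_
    rw [mul_assoc, mul_left_comm]
    gcongr
    have e1 := norm_iteratedFDeriv_comp_le time ht f i x
    have e2 := norm_iteratedFDeriv_comp_le spatial hs g (n - i) x
    have a1 := f.le_seminorm ℝ k i (time x)
    have a0 := f.norm_iteratedFDeriv_le_seminorm ℝ i (time x)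
    have b1 := g.le_seminorm ℝ k (n - i) (spatial x)
    have b0 := g.norm_iteratedFDeriv_le_seminorm ℝ (n - i) (spatial x)
    calc _ ≤ (‖time x‖ ^ k + ‖spatial x‖ ^ k) * (‖iteratedFDeriv ℝ i f (time x)‖ *
            ‖iteratedFDeriv ℝ (n - i) g (spatial x)‖) := by gcongr
      _ = (‖time x‖ ^ k * ‖iteratedFDeriv ℝ i f (time x)‖) *
            ‖iteratedFDeriv ℝ (n - i) g (spatial x)‖ +
          ‖iteratedFDeriv ℝ i f (time x)‖ *
            (‖spatial x‖ ^ k * ‖iteratedFDeriv ℝ (n - i) g (spatial x)‖) := by ring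
      _ ≤ _ := by gcongr

theorem lineDeriv_tensor (f : 𝓢(ℝ, ℂ)) (g : 𝓢(E3, ℂ)) :
    ∂_{(EuclideanSpace.single 3 1 : E4)} (tensor f g) =
      tensor f (∂_{(EuclideanSpace.single 2 1 : E3)} g) := by
  ext x
  have e1 : time (EuclideanSpace.single 3 1 : E4) = 0 := by simp [time]
  have e2 : spatial (EuclideanSpace.single 3 1 : E4) = EuclideanSpace.single 2 1 := by
    ext i; fin_cases i <;> simp [spatial]
  have hf : HasFDerivAt (fun y => f (time y)) ((fderiv ℝ f (time x)).comp time) x :=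
    (f.hasFDerivAt (time x)).comp x time.hasFDerivAt
  have hg : HasFDerivAt (fun y => g (spatial y)) ((fderiv ℝ g (spatial x)).comp spatial) x :=
    (g.hasFDerivAt (spatial x)).comp x spatial.hasFDerivAt
  have h : HasFDerivAt (tensor f g) _ x := hf.mul hg
  rw [SchwartzMap.lineDerivOp_apply_eq_fderiv, h.fderiv]
  change _ = f (time x) * (∂_{(EuclideanSpace.single 2 1 : E3)} g) (spatial x)
  rw [SchwartzMap.lineDerivOp_apply_eq_fderiv]
  simp [e1, e2]

theorem tensor_mem (f : 𝓢(ℝ, ℂ)) {g : 𝓢(E3, ℂ)} (hg : g ∈ tameSpace (2 : Fin 3)) :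
    tensor f g ∈ tameSpace (3 : Fin 4) := by
  rw [tameSpace, Submodule.mem_iInf] at hg ⊢
  intro k
  obtain ⟨h, rfl⟩ := hg k
  refine ⟨tensor f h, ?_⟩
  rw [Module.End.pow_apply, Module.End.pow_apply]
  exact (Function.Semiconj.iterate_right (f := tensor f)
    (fun g' => (lineDeriv_tensor f g').symm) k h).symm

/-- The tensor product `f ⊗ g ∈ 𝓢_{∂₋}(ℝ⁴)` of `f ∈ 𝓢(ℝ)` and `g ∈ 𝓢_{∂₋}(ℝ³)`. -/
def tameTensor (f : 𝓢(ℝ, ℂ)) (g : tameSpace (2 : Fin 3)) : tameSpace (3 : Fin 4) :=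
  ⟨tensor f g, tensor_mem f g.2⟩

/-- `(U_s)` is a family in `𝓢'_{∂₋}(ℝ³)` through which `u ∈ 𝓢'_{∂₋}(ℝ⁴)` is `C^∞`-dependent on
the parameter `x⁺ ∈ Ω`: `(u, f ⊗ g) = ∫_Ω (U_s, g) f(s) ds` for all `f ∈ 𝓓(Ω)` and
`g ∈ 𝓢_{∂₋}(ℝ³)`, and `s ↦ (U_s, g)` is smooth on `Ω` (values of `U` outside `Ω` are
irrelevant). -/
structure IsParameterFamily (u : TameDual (3 : Fin 4)) (Ω : Set ℝ)
    (U : ℝ → TameDual (2 : Fin 3)) : Prop where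
  smooth : ∀ g : tameSpace (2 : Fin 3), ContDiffOn ℝ ∞ (fun s => U s g) Ω
  apply_tensor : ∀ f : 𝓢(ℝ, ℂ), HasCompactSupport f → tsupport f ⊆ Ω →
    ∀ g : tameSpace (2 : Fin 3), u (tameTensor f g) = ∫ s in Ω, U s g * f s

/-- `u ∈ 𝓢'(ℝ⁴)` admits a tame restriction to `{x⁺ = 0}`, and this restriction is `v`. -/
def HasTameRestriction (u : 𝓢'(E4, ℂ)) (v : TameDual (2 : Fin 3)) : Prop :=
  ∃ (Ω : Set ℝ) (U : ℝ → TameDual (2 : Fin 3)), IsOpen Ω ∧ (0 : ℝ) ∈ Ω ∧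
    IsParameterFamily (relax 3 u) Ω U ∧ U 0 = v

/-! ### The distribution `δ(x_⊥) ⊗ ε(x⁻)` -/

/-- The point `(0, 0, t)` of `ℝ³`, as a linear function of `t`. -/
def minusAxis : ℝ →L[ℝ] E3 :=
  LinearMap.toContinuousLinearMap
    { toFun := fun t => !₂[0, 0, t]
      map_add' := by intro x y; ext i; fin_cases i <;> simp
      map_smul' := by intro c x; ext i; fin_cases i <;> simp }

theorem norm_minusAxis (t : ℝ) : ‖minusAxis t‖ = ‖t‖ := by
  rw [EuclideanSpace.norm_eq]
  simp [minusAxis, Fin.sum_univ_three, Real.sqrt_sq_eq_abs]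

/-- Restriction of a Schwartz function on `ℝ³` to the axis `{x_⊥ = 0}`. -/
def restrictAxis : 𝓢(E3, ℂ) →L[ℂ] 𝓢(ℝ, ℂ) :=
  SchwartzMap.compCLMOfAntilipschitz ℂ (K := 1) minusAxis.hasTemperateGrowth
    (AddMonoidHomClass.antilipschitz_of_bound minusAxis fun t => by
      rw [norm_minusAxis]; simp)

theorem norm_sign_mul_le (t : ℝ) (z : ℂ) : ‖(Real.sign t : ℂ) * z‖ ≤ ‖z‖ := by
  rcases Real.sign_apply_eq t with h | h | h <;> simp [h]

theorem integrable_sign_mul (g : 𝓢(ℝ, ℂ)) :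
    Integrable (fun t : ℝ => (Real.sign t : ℂ) * g t) := by
  refine Integrable.mono' g.integrable.norm ?_
    (Filter.Eventually.of_forall fun t => norm_sign_mul_le t (g t))
  have hm : Measurable Real.sign :=
    Measurable.ite measurableSet_Iio measurable_const
      (Measurable.ite measurableSet_Ioi measurable_const measurable_const)
  exact ((Complex.measurable_ofReal.comp hm).mul g.continuous.measurable).aestronglyMeasurable

theorem sign_bound : ∃ (s : Finset (ℕ × ℕ)) (C : ℝ), 0 ≤ C ∧ ∀ f : 𝓢(ℝ, ℂ),
    ‖∫ t : ℝ, (Real.sign t : ℂ) * f t‖ ≤ C * s.sup (schwartzSeminormFamily ℂ ℝ ℂ) f := by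
  have hint : Integrable (fun t : ℝ => (1 + ‖t‖) ^ (-(2 : ℝ))) :=
    integrable_one_add_norm (E := ℝ) (μ := volume) (r := 2) (by simp)
  refine ⟨Finset.Iic (2, 0), 2 ^ 2 * ∫ t : ℝ, (1 + ‖t‖) ^ (-(2 : ℝ)),
    mul_nonneg (by positivity) (integral_nonneg fun t => by positivity), fun f => ?_⟩
  have h := norm_integral_le_of_norm_le (f := fun t : ℝ => (Real.sign t : ℂ) * f t)
    (hint.const_mul (2 ^ 2 * (Finset.Iic (2, 0)).sup (schwartzSeminormFamily ℂ ℝ ℂ) f))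
    (Filter.Eventually.of_forall fun t => by
      refine (norm_sign_mul_le t (f t)).trans ?_
      have h1 := SchwartzMap.one_add_le_sup_seminorm_apply (𝕜 := ℂ) (m := (2, 0)) (k := 2)
        (n := 0) le_rfl le_rfl f t
      rw [norm_iteratedFDeriv_zero] at h1
      rw [Real.rpow_neg (by positivity), ← div_eq_mul_inv, le_div_iff₀ (by positivity), mul_comm]
      exact_mod_cast h1)
  rw [integral_const_mul] at h
  exact h.trans (le_of_eq (by ring))

/-- The tempered distribution `ε` on `ℝ`, given by the sign function. -/
def signCLM : 𝓢(ℝ, ℂ) →L[ℂ] ℂ :=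
  SchwartzMap.mkCLMtoNormedSpace (fun g => ∫ t : ℝ, (Real.sign t : ℂ) * g t)
    (by
      intro f g
      rw [← integral_add (integrable_sign_mul f) (integrable_sign_mul g)]
      congr 1
      ext t
      simp [mul_add])
    (by
      intro a f
      rw [smul_eq_mul, RingHom.id_apply, ← integral_const_mul]
      congr 1
      ext t
      simp [mul_left_comm])
    sign_bound

/-- The tempered distribution `δ(x_⊥) ⊗ ε(x⁻)` on `ℝ³`, where `ε` is the sign function
(see `deltaSign_apply`). -/
def deltaSign : 𝓢'(E3, ℂ) :=
  ContinuousLinearMap.toPointwiseConvergenceCLM _ _ _ _ (signCLM.comp restrictAxis)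

theorem deltaSign_apply (g : 𝓢(E3, ℂ)) :
    deltaSign g = ∫ t : ℝ, (Real.sign t : ℂ) * g !₂[0, 0, t] := rfl

/-! ### Free fields -/

/-- For a tempered distribution `T` on `ℝ^ι`, the pairing of the distribution `T(x - y)` on
`ℝ^ι × ℝ^ι` with `f(x) g(y)`, i.e. the value of `T` on the Schwartz function
`z ↦ ∫ f(z + y) g(y) dy`, which is the convolution of `f` and `y ↦ g(-y)`. -/
def differencePairing {ι : Type} [Fintype ι] (T : 𝓢'(EuclideanSpace ℝ ι, ℂ))
    (f g : 𝓢(EuclideanSpace ℝ ι, ℂ)) : ℂ :=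
  T (SchwartzMap.convolution (ContinuousLinearMap.mul ℂ ℂ) f
    (SchwartzMap.compCLMOfContinuousLinearEquiv ℂ (ContinuousLinearEquiv.neg ℝ) g))

/-- The Klein-Gordon operator `∂₀² - ∂₁² - ∂₂² - ∂₃² + m²` on Schwartz functions. -/
def kleinGordon (m : ℝ) (f : 𝓢(E4, ℂ)) : 𝓢(E4, ℂ) :=
  ∂_{(EuclideanSpace.single 0 1 : E4)} (∂_{(EuclideanSpace.single 0 1 : E4)} f)
    - ∂_{(EuclideanSpace.single 1 1 : E4)} (∂_{(EuclideanSpace.single 1 1 : E4)} f)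
    - ∂_{(EuclideanSpace.single 2 1 : E4)} (∂_{(EuclideanSpace.single 2 1 : E4)} f)
    - ∂_{(EuclideanSpace.single 3 1 : E4)} (∂_{(EuclideanSpace.single 3 1 : E4)} f)
    + ((m : ℂ) ^ 2) • f

/-- The complex conjugate of a Schwartz function. -/
def conjSchwartz (f : 𝓢(E4, ℂ)) : 𝓢(E4, ℂ) :=
  f.postcompCLM (Complex.conjCLE : ℂ →L[ℝ] ℂ)

/-- A real scalar free field of mass `m`: an operator-valued tempered distribution `φ` on a common
invariant domain `V` (a complex inner product space) which is hermitian, solves the Klein-Gordon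
equation and obeys the commutator relation `[φ(x), φ(y)] = -i D_m(x - y)`. -/
structure IsFreeField {V : Type*} [NormedAddCommGroup V] [InnerProductSpace ℂ V]
    (m : ℝ) (φ : 𝓢(E4, ℂ) →ₗ[ℂ] Module.End ℂ V) : Prop where
  continuous : ∀ ψ χ : V, Continuous fun f => inner ℂ ψ (φ f χ)
  hermitian : ∀ (f : 𝓢(E4, ℂ)) (ψ χ : V), inner ℂ (φ f ψ) χ = inner ℂ ψ (φ (conjSchwartz f) χ)
  kleinGordon_eq_zero : ∀ f : 𝓢(E4, ℂ), φ (kleinGordon m f) = 0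
  commutator : ∀ f g : 𝓢(E4, ℂ), φ f * φ g - φ g * φ f =
    (-Complex.I * differencePairing (pauliJordan m) f g) • (1 : Module.End ℂ V)

/-- The field `φ̃ = φ ∘ κ⁻¹` in light-cone coordinates, `φ̃(F) = φ(F ∘ κ)`. -/
def fieldLC {V : Type*} [NormedAddCommGroup V] [InnerProductSpace ℂ V]
    (φ : 𝓢(E4, ℂ) →ₗ[ℂ] Module.End ℂ V) : 𝓢(E4, ℂ) →ₗ[ℂ] Module.End ℂ V :=
  φ ∘ₗ (compKappa : 𝓢(E4, ℂ) →ₗ[ℂ] 𝓢(E4, ℂ))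

/-- The operator-valued distribution `Φ` admits a tame restriction to `{x⁺ = 0}`, and this
restriction is `Φ₀`: there are operator-valued `Φ_s`, `s ∈ Ω`, on `𝓢_{∂₋}(ℝ³)` such that every
matrix element of `Φ` is `C^∞`-dependent on `x⁺ = s ∈ Ω` through the corresponding matrix elements
of `Φ_s`. -/
def HasTameFieldRestriction {V : Type*} [NormedAddCommGroup V] [InnerProductSpace ℂ V]
    (Φ : 𝓢(E4, ℂ) →ₗ[ℂ] Module.End ℂ V)
    (Φ₀ : tameSpace (2 : Fin 3) →ₗ[ℂ] Module.End ℂ V) : Prop :=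
  ∃ (Ω : Set ℝ) (Φs : ℝ → tameSpace (2 : Fin 3) →ₗ[ℂ] Module.End ℂ V),
    IsOpen Ω ∧ (0 : ℝ) ∈ Ω ∧ Φs 0 = Φ₀ ∧
    ∀ ψ χ : V, ∃ (u : 𝓢'(E4, ℂ)) (U : ℝ → TameDual (2 : Fin 3)),
      (∀ F : 𝓢(E4, ℂ), u F = inner ℂ ψ (Φ F χ)) ∧
      (∀ s ∈ Ω, ∀ g : tameSpace (2 : Fin 3), U s g = inner ℂ ψ (Φs s g χ)) ∧
      IsParameterFamily (relax 3 u) Ω U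

end LightCone

end

noncomputable section

namespace LightCone

/-! ### Oscillatory integrals -/

/-! The proof describes both sheets of the mass shell by the light-cone momentum $q=(p_\bot,p^+)$.
For fixed $p_\bot$ and $b=p_\bot^2+m^2>0$, the map $q\mapsto (q-b/(2q))/\sqrt2$ carries $(0,\infty)$
bijectively onto the $p^3$-axis and turns $dp^3/(2\omega)$ into $dq/(2q)$ (`integral_hyperbola`).
The lower sheet is minus the upper one, so it corresponds to $q<0$, and the sign $\epsilon(p^0)$ is
absorbed by the odd weight $1/(2q)$ (`deltaShell_sub`). In these variables $\langle x,p\rangle =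
x^+p^- + x^-p^+ - x_\bot p_\bot$ with $p^-=b/(2p^+)$. Hence on $f\otimes g$ the Pauli–Jordan
function is $\int f(s)\,U_s(g)\,ds$, where $U_s(g)=\frac{1}{i(2\pi)^3}\int e^{isp^-}\hat
g(q)\,\frac{dq}{2p^+}$ (`pauliJordanLC_tensor`).

Tameness is what makes $U_s$ meaningful and smooth in $s$: $g=\partial_-^kG$ gives $\hat g$ a factor
$(p^+)^k$, which cancels the weight $1/p^+$ and the powers of $p^-$ produced by differentiating in
$s$ (`integrable_lcEnergy_pow_mul`). At $s=0$ the mass disappears with the exponential. Writing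
$g=\partial_-G$, Fourier inversion gives $U_0(g)=-G(0)/2$, while $\delta\otimes\epsilon$ gives
$-2G(0)$; this is the factor $1/4$ (`lcRestriction_zero`). Uniqueness holds because a continuous
function is determined by its integrals against test functions (`eqOn_of_integral_mul_eq`).

For the field, the commutator smeared with $f\otimes g_1$ and $h\otimes g_2$ is
$-i\langle\psi,\chi\rangle\iint U_{t-r}(g_1\star g_2)f(t)h(r)\,dr\,dt$ between $\psi$ and $\chi$,
where $\star$ is correlation. Only matrix elements of a single field restrict, so the two time
smearings are removed one after the other. Hermiticity moves the factor not being restricted into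
the bra (`IsFieldFamily.inner_commutator_field`, `IsFieldFamily.inner_commutator`). Setting both
times to $0$ leaves $-iU_0$; no joint regularity in the two times is needed. -/

theorem norm_cexp_I_mul_ofReal (t : ℝ) : ‖Complex.exp (Complex.I * t)‖ = 1 := by
  rw [mul_comm, Complex.norm_exp_ofReal_mul_I]

theorem integrable_mul_cexp {α : Type*} [MeasurableSpace α] {μ : Measure α} {φ : α → ℝ}
    (hφ : Measurable φ) {k : α → ℂ} (hk : Integrable k μ) :
    Integrable (fun a => k a * Complex.exp (Complex.I * (φ a : ℝ))) μ := by
  refine hk.mul_bdd (c := 1) ?_ (Filter.Eventually.of_forall fun a => ?_)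
  · apply Measurable.aestronglyMeasurable
    fun_prop
  · rw [norm_cexp_I_mul_ofReal]

theorem hasDerivAt_integral_mul_cexp {α : Type*} [MeasurableSpace α] {μ : Measure α} {φ : α → ℝ}
    (hφ : Measurable φ) {k : α → ℂ} (hk : Integrable k μ)
    (hk' : Integrable (fun a => Complex.I * φ a * k a) μ) (s : ℝ) :
    HasDerivAt (fun s : ℝ => ∫ a, k a * Complex.exp (Complex.I * (s * φ a : ℝ)) ∂μ)
      (∫ a, (Complex.I * φ a * k a) * Complex.exp (Complex.I * (s * φ a : ℝ)) ∂μ) s := by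
  refine (hasDerivAt_integral_of_dominated_loc_of_deriv_le
    (F := fun (s : ℝ) a => k a * Complex.exp (Complex.I * (s * φ a : ℝ)))
    (F' := fun (s : ℝ) a => (Complex.I * φ a * k a) * Complex.exp (Complex.I * (s * φ a : ℝ)))
    (bound := fun a => ‖Complex.I * φ a * k a‖)
    (Filter.univ_mem' fun _ => mem_univ _) ?_ ?_ ?_ ?_ hk'.norm ?_).2
  · exact Filter.Eventually.of_forall fun s =>
      (integrable_mul_cexp (hφ.const_mul s) hk).aestronglyMeasurable
  · exact integrable_mul_cexp (hφ.const_mul s) hk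
  · exact (integrable_mul_cexp (hφ.const_mul s) hk').aestronglyMeasurable
  · refine Filter.Eventually.of_forall fun a s _ => ?_
    rw [norm_mul, norm_cexp_I_mul_ofReal, mul_one]
  · refine Filter.Eventually.of_forall fun a s _ => ?_
    have h1 : HasDerivAt (fun s : ℝ => Complex.I * ((s * φ a : ℝ) : ℂ)) (Complex.I * φ a) s := by
      have := (((hasDerivAt_id s).mul_const (φ a)).ofReal_comp).const_mul Complex.I
      simpa using this
    have := h1.cexp.const_mul (k a)
    convert! this using 1
    ring

/-- Differentiating in $s$ replaces $k$ by $i\varphi k$, which again satisfies the moment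
hypothesis, so the induction runs over all amplitudes $k$ at once. -/
theorem contDiff_integral_mul_cexp {α : Type*} [MeasurableSpace α] {μ : Measure α} {φ : α → ℝ}
    (hφ : Measurable φ) {k : α → ℂ} (hk : ∀ n : ℕ, Integrable (fun a => (φ a : ℂ) ^ n * k a) μ) :
    ContDiff ℝ ∞ (fun s : ℝ => ∫ a, k a * Complex.exp (Complex.I * (s * φ a : ℝ)) ∂μ) := by
  rw [contDiff_infty]
  intro n
  induction n generalizing k with
  | zero =>
    have h0 : Integrable k μ := by simpa using hk 0
    have h1 : Integrable (fun a => Complex.I * φ a * k a) μ := by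
      simpa [mul_assoc] using (hk 1).const_mul Complex.I
    rw [Nat.cast_zero, contDiff_zero]
    exact continuous_iff_continuousAt.2 fun s =>
      (hasDerivAt_integral_mul_cexp hφ h0 h1 s).continuousAt
  | succ n ih =>
    have h0 : Integrable k μ := by simpa using hk 0
    have h1 : Integrable (fun a => Complex.I * φ a * k a) μ := by
      simpa [mul_assoc] using (hk 1).const_mul Complex.I
    have hd := hasDerivAt_integral_mul_cexp hφ h0 h1
    rw [Nat.cast_succ, contDiff_succ_iff_deriv]
    refine ⟨fun s => (hd s).differentiableAt, fun h => absurd h (by simp), ?_⟩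
    rw [show deriv _ = _ from funext fun s => (hd s).deriv]
    refine ih fun j => ?_
    convert! (hk (j + 1)).const_mul Complex.I using 2
    ring

/-! ### Continuous functions tested against compactly supported Schwartz functions -/

theorem integral_eq_setIntegral_of_tsupport_subset {Ω : Set ℝ} {f : 𝓢(ℝ, ℂ)} (hfs : tsupport f ⊆ Ω)
    (a : ℝ → ℂ) : ∫ s, a s * f s = ∫ s in Ω, a s * f s := by
  refine (setIntegral_eq_integral_of_forall_compl_eq_zero fun s hs => ?_).symm
  rw [image_eq_zero_of_notMem_tsupport fun hs' => hs (hfs hs'), mul_zero]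

theorem integrableOn_mul_of_tsupport_subset {Ω : Set ℝ} {f : 𝓢(ℝ, ℂ)} (hf : HasCompactSupport f)
    (hfs : tsupport f ⊆ Ω) {a : ℝ → ℂ} (ha : ContinuousOn a Ω) :
    IntegrableOn (fun s => a s * f s) Ω := by
  have hK : IntegrableOn (fun s => a s * f s) (tsupport f) :=
    ((ha.mono hfs).mul f.continuous.continuousOn).integrableOn_compact hf
  refine (IntegrableOn.integrable_of_forall_notMem_eq_zero hK fun s hs => ?_).integrableOn
  rw [image_eq_zero_of_notMem_tsupport hs, mul_zero]

/-- The fundamental lemma of the calculus of variations gives equality almost everywhere, and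
continuity on the open set upgrades it to every point. It serves the uniqueness statement and each
removal of a time smearing. -/
theorem eqOn_of_integral_mul_eq {Ω : Set ℝ} (hΩ : IsOpen Ω) {a b : ℝ → ℂ}
    (ha : ContinuousOn a Ω) (hb : ContinuousOn b Ω)
    (h : ∀ f : 𝓢(ℝ, ℂ), HasCompactSupport f → tsupport f ⊆ Ω →
      ∫ s in Ω, a s * f s = ∫ s in Ω, b s * f s) : EqOn a b Ω := by
  have hab : ContinuousOn (fun s => a s - b s) Ω := ha.sub hb
  have key : ∀ᵐ s, s ∈ Ω → a s - b s = 0 := by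
    refine hΩ.ae_eq_zero_of_integral_contDiff_smul_eq_zero
      (hab.locallyIntegrableOn hΩ.measurableSet) ?_
    intro g hg hgc hgs
    have hc : HasCompactSupport (fun s => (g s : ℂ)) := hgc.comp_left Complex.ofReal_zero
    have hsm : ContDiff ℝ ∞ (fun s => (g s : ℂ)) := Complex.ofRealCLM.contDiff.comp hg
    have hts : tsupport (fun s => (g s : ℂ)) ⊆ tsupport g :=
      closure_mono (Function.support_comp_subset Complex.ofReal_zero g)
    have key := h (hc.toSchwartzMap hsm) hc (hts.trans hgs)
    have hi : ∀ {c : ℝ → ℂ}, ContinuousOn c Ω → IntegrableOn (fun s => c s * (g s : ℂ)) Ω :=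
      fun hcc => integrableOn_mul_of_tsupport_subset (f := hc.toSchwartzMap hsm) hc
        (hts.trans hgs) hcc
    have h0 : ∫ s in Ω, g s • (a s - b s) = 0 := by
      have : ∀ s, g s • (a s - b s) = a s * (g s : ℂ) - b s * (g s : ℂ) := by
        intro s
        rw [Complex.real_smul]
        ring
      simp only [this]
      rw [integral_sub (hi ha) (hi hb)]
      exact sub_eq_zero.2 key
    rw [← h0]
    refine (setIntegral_eq_integral_of_forall_compl_eq_zero fun s hs => ?_).symm
    rw [image_eq_zero_of_notMem_tsupport fun hs' => hs (hgs hs')]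
    simp
  have hae : a =ᵐ[volume.restrict Ω] b := by
    rw [Filter.EventuallyEq, ae_restrict_iff' hΩ.measurableSet]
    filter_upwards [key] with s hs hsΩ
    exact sub_eq_zero.1 (hs hsΩ)
  exact Measure.eqOn_open_of_ae_eq hae hΩ ha hb

/-! ### Product decompositions of Lebesgue measure -/

/-- `ℝ⁴ ≃ ℝ × ℝ³`, `x ↦ (time x, spatial x)`. -/
def splitTime : E4 ≃ᵐ ℝ × E3 :=
  ((MeasurableEquiv.toLp 2 (Fin 4 → ℝ)).symm.trans
    (MeasurableEquiv.piFinSuccAbove (fun _ : Fin 4 => ℝ) 0)).trans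
    ((MeasurableEquiv.refl ℝ).prodCongr (MeasurableEquiv.toLp 2 (Fin 3 → ℝ)))

theorem splitTime_apply (x : E4) : splitTime x = (time x, spatial x) := by
  refine Prod.ext rfl ?_
  ext i
  fin_cases i <;> rfl

theorem measurePreserving_splitTime : MeasurePreserving splitTime := by
  refine (((EuclideanSpace.volume_preserving_symm_measurableEquiv_toLp (Fin 4)).trans
    (volume_preserving_piFinSuccAbove (fun _ : Fin 4 => ℝ) 0))).trans ?_
  exact (MeasurePreserving.id volume).prod (PiLp.volume_preserving_toLp (Fin 3))

theorem integral_mul_time_spatial (f : ℝ → ℂ) (g : E3 → ℂ) :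
    ∫ x : E4, f (time x) * g (spatial x) = (∫ s, f s) * ∫ y, g y := by
  rw [← integral_prod_mul, ← Measure.volume_eq_prod,
    ← measurePreserving_splitTime.integral_comp' (fun z : ℝ × E3 => f z.1 * g z.2)]
  simp only [splitTime_apply]

/-- `ℝ³ ≃ ℝ × ℝ²`, with the last coordinate first. -/
def splitMinus : E3 ≃ᵐ ℝ × (Fin 2 → ℝ) :=
  (MeasurableEquiv.toLp 2 (Fin 3 → ℝ)).symm.trans
    (MeasurableEquiv.piFinSuccAbove (fun _ : Fin 3 => ℝ) 2)

theorem splitMinus_symm_apply (t : ℝ) (y : Fin 2 → ℝ) :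
    splitMinus.symm (t, y) = !₂[y 0, y 1, t] := by
  rw [MeasurableEquiv.symm_apply_eq]
  refine Prod.ext rfl ?_
  ext i
  fin_cases i <;> rfl

theorem measurePreserving_splitMinus : MeasurePreserving splitMinus :=
  (EuclideanSpace.volume_preserving_symm_measurableEquiv_toLp (Fin 3)).trans
    (volume_preserving_piFinSuccAbove (fun _ : Fin 3 => ℝ) 2)

theorem integral_eq_iterated {K : E3 → ℂ} (hK : Integrable K) :
    ∫ p, K p = ∫ y : Fin 2 → ℝ, ∫ t : ℝ, K !₂[y 0, y 1, t] := by
  rw [← measurePreserving_splitMinus.symm.integral_comp' K, Measure.volume_eq_prod,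
    integral_prod_symm]
  · simp only [splitMinus_symm_apply]
  · rw [← Measure.volume_eq_prod]
    exact (measurePreserving_splitMinus.symm.integrable_comp_emb
      splitMinus.symm.measurableEmbedding).2 hK

/-! ### The light-cone substitution on a hyperbola -/

/-- With $p=b/(2q)$ this is $(q-p)^2+4pq=(q+p)^2$: the right side is the energy $(p^++p^-)/\sqrt2$.
-/
theorem hyperbola_sqrt {b q : ℝ} (hq : 0 < q) (hb : 0 < b) :
    Real.sqrt (((q - b / (2 * q)) / √2) ^ 2 + b) = (q + b / (2 * q)) / √2 := by
  have h2 : √2 ^ 2 = (2 : ℝ) := Real.sq_sqrt (by norm_num)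
  rw [Real.sqrt_eq_iff_mul_self_eq (by positivity) (by positivity), ← sq, div_pow, div_pow, h2]
  field_simp
  ring

theorem image_hyperbola {b : ℝ} (hb : 0 < b) :
    (fun q : ℝ => (q - b / (2 * q)) / √2) '' Ioi 0 = univ := by
  have h2 : √2 ^ 2 = (2 : ℝ) := Real.sq_sqrt (by norm_num)
  refine eq_univ_of_forall fun t => ?_
  have hs : Real.sqrt (t ^ 2 + b) ^ 2 = t ^ 2 + b := Real.sq_sqrt (by positivity)
  have hlt : |t| < Real.sqrt (t ^ 2 + b) := by
    rw [← Real.sqrt_sq_eq_abs]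
    exact Real.sqrt_lt_sqrt (sq_nonneg t) (by linarith)
  have hpos : 0 < Real.sqrt (t ^ 2 + b) + t := by
    have := neg_abs_le t
    linarith
  -- The preimage is $p^+=(p^0+p^3)/\sqrt2$ with $p^0=\sqrt{t^2+b}$ and $p^3=t$.
  refine ⟨(Real.sqrt (t ^ 2 + b) + t) / √2, by simp only [mem_Ioi]; positivity, ?_⟩
  simp only
  generalize Real.sqrt (t ^ 2 + b) = w at hs hpos
  have : b = (w - t) * (w + t) := by linarith
  rw [this]
  field_simp
  rw [h2]
  ring

theorem injOn_hyperbola {b : ℝ} (hb : 0 < b) :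
    InjOn (fun q : ℝ => (q - b / (2 * q)) / √2) (Ioi 0) := by
  intro q hq r hr h
  have hq : 0 < q := hq
  have hr : 0 < r := hr
  simp only at h
  have h' : q - b / (2 * q) = r - b / (2 * r) := by
    field_simp at h ⊢
    exact h
  -- Clearing denominators factors the difference of the two values; the second factor is positive.
  have : (q - r) * (2 * q * r + b) = 0 := by
    field_simp at h'
    linear_combination h'
  rcases mul_eq_zero.1 this with h0 | h0
  · linarith
  · have : 0 < 2 * q * r + b := by positivity
    linarith

/-- The derivative of the substitution is $\sqrt{t^2+b}/q$, so $dt/\sqrt{t^2+b}=dq/q$. The change of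
variables is valid for arbitrary $K$, integrable or not. -/
theorem integral_hyperbola {b : ℝ} (hb : 0 < b) (K : ℝ → ℂ) :
    ∫ t : ℝ, K t / (2 * (Real.sqrt (t ^ 2 + b) : ℂ)) =
      ∫ q in Ioi (0 : ℝ), K ((q - b / (2 * q)) / √2) / (2 * (q : ℂ)) := by
  have hd : ∀ q ∈ Ioi (0 : ℝ), HasDerivWithinAt (fun q : ℝ => (q - b / (2 * q)) / √2)
      ((1 + b / (2 * q ^ 2)) / √2) (Ioi 0) q := by
    intro q hq
    have hq : 0 < q := hq
    have h1 : HasDerivAt (fun q : ℝ => b / (2 * q)) _ q :=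
      (hasDerivAt_const q b).div ((hasDerivAt_id q).const_mul 2) (by simpa using hq.ne')
    have h2 := ((hasDerivAt_id q).sub h1).div_const √2
    refine (h2.congr_deriv ?_).hasDerivWithinAt
    simp
    field_simp
    ring
  rw [← setIntegral_univ, ← image_hyperbola hb,
    integral_image_eq_integral_abs_deriv_smul measurableSet_Ioi hd (injOn_hyperbola hb)]
  refine setIntegral_congr_fun measurableSet_Ioi fun q hq => ?_
  have hq : 0 < q := hq
  rw [hyperbola_sqrt hq hb, abs_of_pos (by positivity), Complex.real_smul]
  have h2 : (0 : ℝ) < √2 := by positivity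
  have e : ((1 + b / (2 * q ^ 2)) / √2 : ℝ) = ((q + b / (2 * q)) / √2) / q := by
    field_simp
  have hne : (((q + b / (2 * q)) / √2 : ℝ) : ℂ) ≠ 0 :=
    Complex.ofReal_ne_zero.2 (by positivity)
  rw [e, Complex.ofReal_div ((q + b / (2 * q)) / √2) q]
  have hq' : (q : ℂ) ≠ 0 := Complex.ofReal_ne_zero.2 hq.ne'
  generalize (q + b / (2 * q)) / √2 = w at hne
  generalize K ((q - b / (2 * q)) / √2) = z
  field_simp

/-! ### The spatial Fourier transform in light-cone coordinates -/

/-- The reflection `(q¹, q², q⁻) ↦ (q¹, q², -q⁻)`. -/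
def reflectMinus : E3 ≃ₗᵢ[ℝ] E3 where
  toFun q := !₂[q 0, q 1, -q 2]
  invFun q := !₂[q 0, q 1, -q 2]
  map_add' x y := by ext i; fin_cases i <;> simp; ring
  map_smul' c x := by ext i; fin_cases i <;> simp
  left_inv x := by ext i; fin_cases i <;> simp
  right_inv x := by ext i; fin_cases i <;> simp
  norm_map' x := by
    rw [EuclideanSpace.norm_eq, EuclideanSpace.norm_eq]
    congr 1
    simp [Fin.sum_univ_three]

theorem reflectMinus_apply (q : E3) : reflectMinus q = !₂[q 0, q 1, -q 2] := rfl

/-- The linear isomorphism `q ↦ (q¹, q², -q⁻) / (2π)`. -/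
def lcScale : E3 ≃L[ℝ] E3 :=
  (reflectMinus.toLinearEquiv.trans
    (LinearEquiv.smulOfNeZero ℝ E3 (2 * Real.pi)⁻¹
      (inv_ne_zero (by positivity)))).toContinuousLinearEquiv

theorem lcScale_apply (q : E3) : lcScale q = (2 * Real.pi)⁻¹ • reflectMinus q := rfl

/-- The Fourier transform `g ↦ (q ↦ ∫ g(y) exp(i(y⁻q⁻ - y¹q¹ - y²q²)) dy)`. -/
def lcFourier : 𝓢(E3, ℂ) →L[ℂ] 𝓢(E3, ℂ) :=
  (SchwartzMap.compCLMOfContinuousLinearEquiv ℂ lcScale).comp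
    (FourierTransform.fourierCLM ℂ 𝓢(E3, ℂ))

theorem lcFourier_eq (g : 𝓢(E3, ℂ)) (q : E3) : lcFourier g q = 𝓕 g (lcScale q) := rfl

theorem lcFourier_apply (g : 𝓢(E3, ℂ)) (q : E3) :
    lcFourier g q =
      ∫ y : E3, g y * Complex.exp (Complex.I * (y 2 * q 2 - y 0 * q 0 - y 1 * q 1 : ℝ)) := by
  have h : lcFourier g q = 𝓕 (g : E3 → ℂ) (lcScale q) := rfl
  rw [h, Real.fourier_eq']
  congr 1
  ext y
  rw [smul_eq_mul, mul_comm]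
  congr 2
  have : (-2 * Real.pi * inner ℝ y (lcScale q) : ℝ) = y 2 * q 2 - y 0 * q 0 - y 1 * q 1 := by
    have := Real.pi_ne_zero
    rw [lcScale_apply, reflectMinus_apply, inner_smul_right]
    simp only [PiLp.inner_apply, Fin.sum_univ_three]
    simp
    field_simp
    ring
  rw [this, mul_comm]

theorem lcFourier_lineDeriv (g : 𝓢(E3, ℂ)) (q : E3) :
    lcFourier (∂_{(EuclideanSpace.single 2 1 : E3)} g) q = -Complex.I * q 2 * lcFourier g q := by
  have hg : (inner ℝ · (EuclideanSpace.single 2 1 : E3)).HasTemperateGrowth :=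
    ((innerSL ℝ).flip (EuclideanSpace.single 2 1 : E3)).hasTemperateGrowth
  have hi : inner ℝ (lcScale q) (EuclideanSpace.single 2 1 : E3) = -(q 2) / (2 * Real.pi) := by
    rw [lcScale_apply, reflectMinus_apply, inner_smul_left]
    simp [PiLp.inner_apply]
    field_simp
  rw [lcFourier_eq, lcFourier_eq, SchwartzMap.fourier_lineDerivOp_eq, smul_apply,
    SchwartzMap.smulLeftCLM_apply_apply hg, hi, Complex.real_smul, smul_eq_mul]
  have : (Real.pi : ℂ) ≠ 0 := Complex.ofReal_ne_zero.2 Real.pi_ne_zero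
  push_cast
  field_simp

theorem lcFourier_iterate_lineDeriv (g : 𝓢(E3, ℂ)) (q : E3) (n : ℕ) :
    lcFourier ((∂_{(EuclideanSpace.single 2 1 : E3)})^[n] g) q =
      (-Complex.I * q 2) ^ n * lcFourier g q := by
  induction n with
  | zero => simp
  | succ n ih => rw [Function.iterate_succ_apply', lcFourier_lineDeriv, ih, pow_succ]; ring

/-- Fourier inversion at the origin; the reflection preserves volume and the dilation by
$(2\pi)^{-1}$ contributes $(2\pi)^3$. -/
theorem integral_lcFourier (g : 𝓢(E3, ℂ)) :
    ∫ q, lcFourier g q = (2 * Real.pi : ℂ) ^ 3 * g 0 := by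
  have h1 : ∫ q, lcFourier g q = ∫ q, 𝓕 g ((2 * Real.pi)⁻¹ • q) :=
    reflectMinus.measurePreserving.integral_comp
      reflectMinus.toHomeomorph.measurableEmbedding (fun q => 𝓕 g ((2 * Real.pi)⁻¹ • q))
  have h2 : ∫ q, 𝓕 g q = g 0 := by
    have h : 𝓕⁻ (𝓕 g) = g := by simp
    have h' : 𝓕⁻ (𝓕 g) (0 : E3) = ∫ q, 𝓕 g q := by
      rw [SchwartzMap.fourierInv_coe, Real.fourierInv_eq]
      simp
    rw [← h', h]
  rw [h1, Measure.integral_comp_smul, h2, abs_of_pos (by positivity), Complex.real_smul,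
    inv_pow, inv_inv]
  simp

/-! ### Tame test functions -/

theorem mem_tameSpace_iff {ι : Type} [Fintype ι] [DecidableEq ι] {i : ι}
    {g : 𝓢(EuclideanSpace ℝ ι, ℂ)} :
    g ∈ tameSpace i ↔ ∀ k : ℕ, ∃ G : 𝓢(EuclideanSpace ℝ ι, ℂ),
      (∂_{(EuclideanSpace.single i 1 : EuclideanSpace ℝ ι)})^[k] G = g := by
  rw [tameSpace, Submodule.mem_iInf]
  refine forall_congr' fun k => exists_congr fun G => ?_
  rw [Module.End.pow_apply]
  rfl

theorem lcFourier_eq_zero {g : 𝓢(E3, ℂ)} (hg : g ∈ tameSpace (2 : Fin 3)) {q : E3}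
    (hq : q 2 = 0) : lcFourier g q = 0 := by
  obtain ⟨G, rfl⟩ := mem_tameSpace_iff.1 hg 1
  simp [lcFourier_lineDeriv, hq]

/-- The mean value inequality along the segment from the hyperplane to $q$. This bounds $\hat g/q^-$
by seminorms of $\hat g$ itself rather than of a primitive of $g$, as continuity for the induced
topology requires. The exponent $4$ exceeds the dimension. -/
theorem norm_le_of_eq_zero_on_hyperplane (h : 𝓢(E3, ℂ)) (h0 : ∀ q : E3, q 2 = 0 → h q = 0)
    (q : E3) :
    ‖h q‖ ≤ 2 ^ 8 * (Finset.Iic (4, 1)).sup (schwartzSeminormFamily ℂ E3 ℂ) h * |q 2| *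
      ((1 + ‖q‖) ^ 4)⁻¹ := by
  set S := (Finset.Iic (4, 1)).sup (schwartzSeminormFamily ℂ E3 ℂ) h with hS
  have hS0 : 0 ≤ S := apply_nonneg _ _
  have b0 : ∀ x, ‖h x‖ ≤ 2 ^ 4 * S * ((1 + ‖x‖) ^ 4)⁻¹ := fun x => by
    have := SchwartzMap.one_add_le_sup_seminorm_apply (𝕜 := ℂ) (m := (4, 1)) (k := 4) (n := 0)
      le_rfl zero_le_one h x
    rw [norm_iteratedFDeriv_zero] at this
    rw [← div_eq_mul_inv, le_div_iff₀ (by positivity), mul_comm]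
    exact this
  have b1 : ∀ x, ‖fderiv ℝ h x‖ ≤ 2 ^ 4 * S * ((1 + ‖x‖) ^ 4)⁻¹ := fun x => by
    have := SchwartzMap.one_add_le_sup_seminorm_apply (𝕜 := ℂ) (m := (4, 1)) (k := 4) (n := 1)
      le_rfl le_rfl h x
    rw [norm_iteratedFDeriv_one] at this
    rw [← div_eq_mul_inv, le_div_iff₀ (by positivity), mul_comm]
    exact this
  rcases le_total 1 |q 2| with h1 | h1
  · refine (b0 q).trans (mul_le_mul_of_nonneg_right ?_ (by positivity))
    nlinarith [mul_le_mul_of_nonneg_left h1 hS0]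
  · set q' : E3 := q - (q 2) • EuclideanSpace.single 2 1 with hq'
    have hz : h q' = 0 := h0 q' (by simp [hq'])
    have hn : ‖q - q'‖ = |q 2| := by simp [hq', norm_smul]
    have hb : ∀ x ∈ segment ℝ q' q, ‖fderiv ℝ h x‖ ≤ 2 ^ 8 * S * ((1 + ‖q‖) ^ 4)⁻¹ := by
      intro x hx
      have hxq : ‖q - x‖ ≤ 1 := by
        obtain ⟨a, b, ha, hb, hab, rfl⟩ := hx
        have e : q - (a • q' + b • q) = a • (q - q') := by
          have : b = 1 - a := by linarith
          rw [this]; module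
        rw [e, norm_smul, Real.norm_of_nonneg ha, hn]
        nlinarith [abs_nonneg (q 2)]
      -- Points of the segment are within distance $1$ of $q$, so the decay at $x$ passes to $q$ at
      -- the cost of a second factor $2^4$.
      have hq2 : 1 + ‖q‖ ≤ 2 * (1 + ‖x‖) := by
        have := norm_le_norm_add_norm_sub' q x
        linarith [norm_nonneg x]
      refine (b1 x).trans ?_
      rw [← div_eq_mul_inv, ← div_eq_mul_inv, div_le_div_iff₀ (by positivity) (by positivity)]
      have h4 : (1 + ‖q‖) ^ 4 ≤ 2 ^ 4 * (1 + ‖x‖) ^ 4 := by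
        rw [← mul_pow]
        gcongr
      nlinarith [mul_le_mul_of_nonneg_left h4 hS0]
    have := (convex_segment q' q).norm_image_sub_le_of_norm_fderiv_le (𝕜 := ℝ) (f := h)
      (fun x _ => h.differentiableAt) hb (left_mem_segment ℝ q' q) (right_mem_segment ℝ q' q)
    rw [hz, sub_zero, hn] at this
    exact this.trans (le_of_eq (by ring))

theorem norm_lcFourier_div_le {g : 𝓢(E3, ℂ)} (hg : g ∈ tameSpace (2 : Fin 3)) (q : E3) :
    ‖lcFourier g q / (2 * (q 2 : ℂ))‖ ≤
      2 ^ 7 * (Finset.Iic (4, 1)).sup (schwartzSeminormFamily ℂ E3 ℂ) (lcFourier g) *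
        ((1 + ‖q‖) ^ 4)⁻¹ := by
  have h := norm_le_of_eq_zero_on_hyperplane (lcFourier g) (fun q hq => lcFourier_eq_zero hg hq) q
  have hS0 : 0 ≤ (Finset.Iic (4, 1)).sup (schwartzSeminormFamily ℂ E3 ℂ) (lcFourier g) :=
    apply_nonneg _ _
  rcases eq_or_ne (q 2) 0 with h0 | h0
  -- On the hyperplane the quotient is $0$ because division by zero is $0$.
  · rw [h0]
    simp
    positivity
  · have hp : 0 < |q 2| := abs_pos.2 h0
    rw [norm_div, norm_mul, Complex.norm_real, Real.norm_eq_abs, Complex.norm_two,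
      div_le_iff₀ (by positivity)]
    exact h.trans (le_of_eq (by ring))

theorem integrable_inv_one_add_norm_pow_four : Integrable (fun q : E3 => ((1 + ‖q‖) ^ 4)⁻¹) := by
  have h := integrable_one_add_norm (E := E3) (μ := volume) (r := 4) (by simp; norm_num)
  refine h.congr (Filter.Eventually.of_forall fun q => ?_)
  simp only
  rw [Real.rpow_neg (by positivity)]
  norm_cast

theorem integrable_lcFourier_div {g : 𝓢(E3, ℂ)} (hg : g ∈ tameSpace (2 : Fin 3)) :
    Integrable (fun q : E3 => lcFourier g q / (2 * (q 2 : ℂ))) := by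
  refine Integrable.mono' (integrable_inv_one_add_norm_pow_four.const_mul _) ?_
    (Filter.Eventually.of_forall fun q => norm_lcFourier_div_le hg q)
  apply Measurable.aestronglyMeasurable
  have := (lcFourier g).continuous.measurable
  fun_prop

/-! ### The restrictions of the Pauli-Jordan function to `x⁺ = s` -/

/-- The light-cone energy `p⁻ = (p_⊥² + m²) / (2p⁺)` as a function of `q = (p_⊥, p⁺)`. -/
def lcEnergy (m : ℝ) (q : E3) : ℝ := (q 0 ^ 2 + q 1 ^ 2 + m ^ 2) / (2 * q 2)

theorem measurable_lcEnergy (m : ℝ) : Measurable (lcEnergy m) := by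
  unfold lcEnergy
  fun_prop

theorem norm_integral_lcFourier_div_le (m s : ℝ) {g : 𝓢(E3, ℂ)}
    (hg : g ∈ tameSpace (2 : Fin 3)) :
    ‖∫ q : E3, lcFourier g q / (2 * (q 2 : ℂ)) * Complex.exp (Complex.I * (s * lcEnergy m q : ℝ))‖ ≤
      2 ^ 7 * (Finset.Iic (4, 1)).sup (schwartzSeminormFamily ℂ E3 ℂ) (lcFourier g) *
        ∫ q : E3, ((1 + ‖q‖) ^ 4)⁻¹ := by
  rw [← integral_const_mul]
  refine norm_integral_le_of_norm_le (integrable_inv_one_add_norm_pow_four.const_mul _)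
    (Filter.Eventually.of_forall fun q => ?_)
  rw [norm_mul, norm_cexp_I_mul_ofReal, mul_one]
  exact norm_lcFourier_div_le hg q

/-- The linear functional underlying `lcRestriction`. -/
def lcRestrictionLM (m s : ℝ) : tameSpace (2 : Fin 3) →ₗ[ℂ] ℂ where
  toFun g := 1 / (Complex.I * (2 * Real.pi) ^ 3) *
    ∫ q : E3, lcFourier g q / (2 * (q 2 : ℂ)) *
      Complex.exp (Complex.I * (s * lcEnergy m q : ℝ))
  map_add' := by
    intro g h
    have hm := (measurable_lcEnergy m).const_mul s
    rw [← mul_add, ← integral_add (integrable_mul_cexp hm (integrable_lcFourier_div g.2))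
      (integrable_mul_cexp hm (integrable_lcFourier_div h.2))]
    congr 2
    funext q
    simp [add_div, add_mul]
  map_smul' := by
    intro c g
    rw [RingHom.id_apply, smul_eq_mul, mul_left_comm, ← integral_const_mul c]
    congr 2
    funext q
    simp
    ring

/-- The functional
`g ↦ (1 / (i (2π)³)) ∫ exp(i s p⁻(q)) ĝ(q) / (2 q⁻) dq` on `𝓢_{∂₋}(ℝ³)`, the restriction of the
Pauli-Jordan function to `x⁺ = s`. -/
def lcRestriction (m s : ℝ) : TameDual (2 : Fin 3) where
  toLinearMap := lcRestrictionLM m s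
  cont := by
    refine continuous_of_continuousAt_zero (lcRestrictionLM m s) ?_
    have hp : Continuous fun g : tameSpace (2 : Fin 3) =>
        (Finset.Iic (4, 1)).sup (schwartzSeminormFamily ℂ E3 ℂ) (lcFourier g) :=
      (Seminorm.continuous_finsetSup fun k _ =>
        (schwartz_withSeminorms ℂ E3 ℂ).continuous_seminorm k).comp
        (lcFourier.continuous.comp continuous_subtype_val)
    rw [ContinuousAt, map_zero]
    refine squeeze_zero_norm (a := fun g : tameSpace (2 : Fin 3) =>
      ‖(1 / (Complex.I * (2 * Real.pi) ^ 3) : ℂ)‖ * (2 ^ 7 *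
        (Finset.Iic (4, 1)).sup (schwartzSeminormFamily ℂ E3 ℂ) (lcFourier g) *
        ∫ q : E3, ((1 + ‖q‖) ^ 4)⁻¹)) (fun g => ?_) ?_
    · refine (norm_mul_le _ _).trans ?_
      gcongr
      exact norm_integral_lcFourier_div_le m s g.2
    · refine Continuous.tendsto' (by fun_prop) _ _ ?_
      simp

theorem lcRestriction_apply (m s : ℝ) (g : tameSpace (2 : Fin 3)) :
    lcRestriction m s g = 1 / (Complex.I * (2 * Real.pi) ^ 3) *
      ∫ q : E3, lcFourier g q / (2 * (q 2 : ℂ)) *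
        Complex.exp (Complex.I * (s * lcEnergy m q : ℝ)) := rfl

theorem integrable_lcEnergy_pow_mul (m : ℝ) (n : ℕ) {g : 𝓢(E3, ℂ)}
    (hg : g ∈ tameSpace (2 : Fin 3)) :
    Integrable (fun q : E3 => (lcEnergy m q : ℂ) ^ n * (lcFourier g q / (2 * (q 2 : ℂ)))) := by
  -- Of the $n+1$ factors $q^-$ gained, $n$ cancel the denominators of the energy and one cancels
  -- the weight. What remains is a polynomial times a Schwartz function, with a constant of modulus
  -- at most $1$.
  obtain ⟨G, rfl⟩ := mem_tameSpace_iff.1 hg (n + 1)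
  have hw : Function.HasTemperateGrowth
      (fun q : E3 => ((q 0 ^ 2 + q 1 ^ 2 + m ^ 2) ^ n : ℝ)) := by
    have hc : ∀ i : Fin 3, Function.HasTemperateGrowth (fun q : E3 => q i) := fun i =>
      (EuclideanSpace.proj i : E3 →L[ℝ] ℝ).hasTemperateGrowth
    have := hc 0
    have := hc 1
    fun_prop
  have hint := (SchwartzMap.smulLeftCLM ℂ (fun q : E3 => ((q 0 ^ 2 + q 1 ^ 2 + m ^ 2) ^ n : ℝ))
    (lcFourier G)).integrable (μ := volume)
  refine hint.norm.mono' ?_ (Filter.Eventually.of_forall fun q => ?_)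
  · apply Measurable.aestronglyMeasurable
    have h1 := measurable_lcEnergy m
    have h2 := (lcFourier ((∂_{(EuclideanSpace.single 2 1 : E3)})^[n + 1] G)).continuous.measurable
    fun_prop
  · rw [SchwartzMap.smulLeftCLM_apply_apply hw, lcFourier_iterate_lineDeriv]
    rcases eq_or_ne (q 2) 0 with h0 | h0
    · simp only [h0, Complex.ofReal_zero, mul_zero, div_zero, norm_zero]
      exact norm_nonneg _
    · have h0' : (q 2 : ℂ) ≠ 0 := Complex.ofReal_ne_zero.2 h0
      have e : (lcEnergy m q : ℂ) ^ n *
          ((-Complex.I * q 2) ^ (n + 1) * lcFourier G q / (2 * (q 2 : ℂ))) =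
          ((-Complex.I / 2) ^ (n + 1)) *
            (((q 0 ^ 2 + q 1 ^ 2 + m ^ 2) ^ n : ℝ) • lcFourier G q) := by
        rw [Complex.real_smul, lcEnergy]
        push_cast
        rw [div_pow, div_pow, mul_pow, mul_pow]
        field_simp
        ring
      rw [e, norm_mul, norm_pow, norm_div, norm_neg, Complex.norm_I, Complex.norm_two]
      exact mul_le_of_le_one_left (norm_nonneg _) (pow_le_one₀ (by norm_num) (by norm_num))

theorem contDiff_lcRestriction (m : ℝ) (g : tameSpace (2 : Fin 3)) :
    ContDiff ℝ ∞ (fun s => lcRestriction m s g) :=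
  contDiff_const.mul (contDiff_integral_mul_cexp (measurable_lcEnergy m)
    fun n => integrable_lcEnergy_pow_mul m n g.2)

/-! ### The value of the restricted functional at $x^+=0$ -/

theorem integral_sign_mul_deriv (G : 𝓢(ℝ, ℂ)) :
    ∫ t : ℝ, (Real.sign t : ℂ) * deriv G t = -2 * G 0 := by
  have hint : Integrable (deriv G) := (SchwartzMap.derivCLM ℂ ℂ G).integrable (μ := volume)
  have htop : Filter.Tendsto G Filter.atTop (nhds 0) :=
    G.tendsto_cocompact.mono_left atTop_le_cocompact
  have hbot : Filter.Tendsto G Filter.atBot (nhds 0) :=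
    G.tendsto_cocompact.mono_left atBot_le_cocompact
  have h1 := integral_Ioi_of_hasDerivAt_of_tendsto' (a := 0) (fun x _ => G.hasDerivAt x)
    hint.integrableOn htop
  have h2 := integral_Iic_of_hasDerivAt_of_tendsto' (a := 0) (fun x _ => G.hasDerivAt x)
    hint.integrableOn hbot
  have hs := integrable_sign_mul (SchwartzMap.derivCLM ℂ ℂ G)
  simp only [SchwartzMap.derivCLM_apply] at hs
  rw [← integral_add_compl (measurableSet_Ioi : MeasurableSet (Ioi (0 : ℝ))) hs, compl_Ioi]
  have e1 : ∫ t in Ioi (0 : ℝ), (Real.sign t : ℂ) * deriv G t = ∫ t in Ioi (0 : ℝ), deriv G t :=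
    setIntegral_congr_fun measurableSet_Ioi fun t ht => by
      simp [Real.sign_of_pos (mem_Ioi.1 ht)]
  have e2 : ∫ t in Iic (0 : ℝ), (Real.sign t : ℂ) * deriv G t =
      -∫ t in Iic (0 : ℝ), deriv G t := by
    rw [integral_Iic_eq_integral_Iio, integral_Iic_eq_integral_Iio, ← integral_neg]
    exact setIntegral_congr_fun measurableSet_Iio fun t ht => by
      simp [Real.sign_of_neg (mem_Iio.1 ht)]
  rw [e1, e2, h1, h2]
  ring

theorem deltaSign_lineDeriv (G : 𝓢(E3, ℂ)) :
    deltaSign (∂_{(EuclideanSpace.single 2 1 : E3)} G) = -2 * G 0 := by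
  have h := integral_sign_mul_deriv (restrictAxis G)
  have h0 : restrictAxis G 0 = G 0 := by
    change G (minusAxis 0) = G 0
    rw [map_zero]
  rw [h0] at h
  rw [← h, deltaSign_apply]
  congr 1
  ext t
  congr 1
  have e : minusAxis 1 = EuclideanSpace.single 2 1 := by
    ext i
    fin_cases i <;> simp [minusAxis]
  have hd : HasDerivAt (restrictAxis G) (fderiv ℝ G (minusAxis t) (minusAxis 1)) t :=
    (G.hasFDerivAt (minusAxis t)).comp_hasDerivAt t minusAxis.hasDerivAt
  rw [hd.deriv, e]
  rfl

theorem ae_apply_two_ne_zero : ∀ᵐ q : E3, q 2 ≠ 0 := by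
  have h := Measure.addHaar_submodule (volume : Measure E3)
    (LinearMap.ker (EuclideanSpace.proj 2 : E3 →L[ℝ] ℝ).toLinearMap) fun h => by
      have : EuclideanSpace.single 2 1 ∈
          LinearMap.ker (EuclideanSpace.proj 2 : E3 →L[ℝ] ℝ).toLinearMap := h ▸ Submodule.mem_top
      simp at this
  refine measure_mono_null (fun q hq => ?_) h
  simpa using hq

/-- The mass enters only through the exponential, which is $1$ at $s=0$. For $g=\partial_-G$ the
integrand becomes $-\frac i2\hat G$, so both sides equal $-G(0)/2$. -/
theorem lcRestriction_zero (m : ℝ) :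
    lcRestriction m 0 = (1 / 4 : ℂ) • relax 2 deltaSign := by
  ext ⟨g, hg⟩
  obtain ⟨G, rfl⟩ := mem_tameSpace_iff.1 hg 1
  have h1 : ((1 / 4 : ℂ) • relax 2 deltaSign)
      ⟨(∂_{(EuclideanSpace.single 2 1 : E3)})^[1] G, hg⟩ =
      1 / 4 * deltaSign (∂_{(EuclideanSpace.single 2 1 : E3)} G) := rfl
  have h2 : ∫ q : E3, lcFourier ((∂_{(EuclideanSpace.single 2 1 : E3)})^[1] G) q / (2 * (q 2 : ℂ)) *
      Complex.exp (Complex.I * (0 * lcEnergy m q : ℝ)) = ∫ q, -Complex.I / 2 * lcFourier G q := by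
    refine integral_congr_ae (ae_apply_two_ne_zero.mono fun q hq => ?_)
    have hq' : (q 2 : ℂ) ≠ 0 := Complex.ofReal_ne_zero.2 hq
    simp only
    rw [lcFourier_iterate_lineDeriv]
    simp
    field_simp
  rw [h1, deltaSign_lineDeriv, lcRestriction_apply, h2, integral_const_mul, integral_lcFourier]
  have : (Real.pi : ℂ) ≠ 0 := Complex.ofReal_ne_zero.2 Real.pi_ne_zero
  have := Complex.I_ne_zero
  field_simp
  ring

/-! ### The mass shell in light-cone coordinates -/

/-- The point `(p⁺, p_⊥, p⁻)` of the mass shell in light-cone coordinates, where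
`q = (p_⊥, p⁺)`. -/
def lcShell (m : ℝ) (q : E3) : E4 := !₂[q 2, q 0, q 1, lcEnergy m q]

theorem lcShell_neg (m : ℝ) (q : E3) : lcShell m (-q) = -lcShell m q := by
  ext i
  fin_cases i <;> simp [lcShell, lcEnergy, div_neg]

theorem omega_eq (m : ℝ) (p : E3) :
    omega m p = Real.sqrt (p 2 ^ 2 + (p 0 ^ 2 + p 1 ^ 2 + m ^ 2)) := by
  rw [omega, EuclideanSpace.norm_sq_eq]
  congr 1
  simp [Fin.sum_univ_three]
  ring

theorem omega_neg (m : ℝ) (p : E3) : omega m (-p) = omega m p := by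
  simp [omega]

theorem shell_neg (m : ℝ) (p : E3) : shell m (-1) (-p) = -shell m 1 p := by
  ext i
  fin_cases i <;> simp [shell, omega_neg]

theorem shell_hyperbola {m : ℝ} (hm : 0 < m) {q : E3} (hq : 0 < q 2) :
    shell m 1 !₂[q 0, q 1, (q 2 - (q 0 ^ 2 + q 1 ^ 2 + m ^ 2) / (2 * q 2)) / √2] =
      kappa (lcShell m q) := by
  have hb : 0 < q 0 ^ 2 + q 1 ^ 2 + m ^ 2 := by positivity
  have hω := hyperbola_sqrt hq hb
  ext i
  fin_cases i
  · simp only [shell, kappa, lcShell, lcEnergy, omega_eq]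
    simpa using hω
  all_goals simp [shell, kappa, lcShell, lcEnergy]

theorem measurableSet_minus_pos : MeasurableSet {q : E3 | 0 < q 2} :=
  measurableSet_lt measurable_const (by fun_prop)

/-- The hyperbola substitution on each line of fixed transverse momentum, joined by Fubini. $H$ is a
plain function so that the lemma also applies to $x\mapsto H(-x)$, which handles the lower sheet. -/
theorem integral_shell {m : ℝ} (hm : 0 < m) (H : E4 → ℂ)
    (h1 : Integrable (fun p => H (shell m 1 p) / (2 * (omega m p : ℂ))))
    (h2 : IntegrableOn (fun q => H (kappa (lcShell m q)) / (2 * (q 2 : ℂ))) {q : E3 | 0 < q 2}) :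
    ∫ p : E3, H (shell m 1 p) / (2 * (omega m p : ℂ)) =
      ∫ q in {q : E3 | 0 < q 2}, H (kappa (lcShell m q)) / (2 * (q 2 : ℂ)) := by
  rw [← integral_indicator measurableSet_minus_pos, integral_eq_iterated h1,
    integral_eq_iterated ((integrable_indicator_iff measurableSet_minus_pos).2 h2)]
  congr 1
  funext y
  have hb : 0 < y 0 ^ 2 + y 1 ^ 2 + m ^ 2 := by positivity
  have e := integral_hyperbola hb (fun t => H (shell m 1 !₂[y 0, y 1, t]))
  simp only [omega_eq]
  refine e.trans ?_
  rw [← integral_indicator measurableSet_Ioi]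
  congr 1
  funext t
  by_cases ht : 0 < t
  · rw [indicator_of_mem (mem_Ioi.2 ht), indicator_of_mem (by simpa using ht)]
    have := shell_hyperbola hm (q := !₂[y 0, y 1, t]) (by simpa using ht)
    rw [← this]
    rfl
  · rw [indicator_of_notMem (by simpa using ht), indicator_of_notMem (by simpa using ht)]

/-- The lower sheet is the negative of the upper one, and $q\mapsto-q$ moves its contribution to
$q^-<0$, where the odd weight supplies the minus sign. The two half-spaces miss only a null
hyperplane. -/
theorem deltaShell_sub {m : ℝ} (hm : 0 < m) (H : 𝓢(E4, ℂ))
    (h : Integrable (fun q => H (kappa (lcShell m q)) / (2 * (q 2 : ℂ)))) :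
    deltaShell m 1 H - deltaShell m (-1) H =
      ∫ q : E3, H (kappa (lcShell m q)) / (2 * (q 2 : ℂ)) := by
  have hneg := h.comp_neg
  have e1 : deltaShell m 1 H =
      ∫ q in {q : E3 | 0 < q 2}, H (kappa (lcShell m q)) / (2 * (q 2 : ℂ)) :=
    integral_shell hm H (integrable_shell H m 1) h.integrableOn
  have e2 : deltaShell m (-1) H =
      ∫ q in {q : E3 | 0 < q 2}, H (-kappa (lcShell m q)) / (2 * (q 2 : ℂ)) := by
    have a1 : deltaShell m (-1) H =
        ∫ p : E3, H (-shell m 1 p) / (2 * (omega m p : ℂ)) := by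
      have := integral_neg_eq_self
        (fun p : E3 => H (shell m (-1) p) / (2 * (omega m p : ℂ))) volume
      simp only [shell_neg, omega_neg] at this
      exact this.symm
    rw [a1]
    refine integral_shell hm (fun x => H (-x)) ?_ ?_
    · have := (integrable_shell H m (-1)).comp_neg
      simpa only [shell_neg, omega_neg] using this
    · refine (hneg.neg.integrableOn (s := {q : E3 | 0 < q 2})).congr_fun (fun q _ => ?_)
        measurableSet_minus_pos
      simp [lcShell_neg, div_neg]
  have e3 : ∫ q in {q : E3 | 0 < q 2}, H (-kappa (lcShell m q)) / (2 * (q 2 : ℂ)) =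
      -∫ q in {q : E3 | 0 < q 2}ᶜ, H (kappa (lcShell m q)) / (2 * (q 2 : ℂ)) := by
    rw [← integral_indicator measurableSet_minus_pos,
      ← integral_indicator measurableSet_minus_pos.compl, ← integral_neg,
      ← integral_neg_eq_self]
    refine integral_congr_ae (ae_apply_two_ne_zero.mono fun q hq => ?_)
    rcases lt_or_gt_of_ne hq with h0 | h0
    · simp only
      rw [indicator_of_mem (by simpa using h0), indicator_of_mem (by simpa using h0.le)]
      simp [lcShell_neg, div_neg]
    · simp only
      rw [indicator_of_notMem (by simpa using h0.le), indicator_of_notMem (by simpa using h0)]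
      simp
  rw [e1, e2, e3, sub_neg_eq_add, integral_add_compl measurableSet_minus_pos h]

/-- In light-cone coordinates $x^+$ pairs with $p^-$ alone, so the exponential splits into a time
factor and a spatial factor. -/
theorem mink_kappa_lcShell (m : ℝ) (y : E4) (q : E3) :
    mink (kappa y) (kappa (lcShell m q)) =
      time y * lcEnergy m q +
        (spatial y 2 * q 2 - spatial y 0 * q 0 - spatial y 1 * q 1) := by
  have h : √2 ^ 2 = (2 : ℝ) := Real.sq_sqrt (by norm_num)
  simp [mink, kappa, lcShell, time, spatial]
  field_simp
  rw [h]
  ring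

theorem kappa_kappa (x : E4) : kappa (kappa x) = x := kappa.left_inv x

theorem integral_comp_kappa (F : E4 → ℂ) : ∫ x, F (kappa x) = ∫ x, F x :=
  kappa.measurePreserving.integral_comp kappa.toHomeomorph.measurableEmbedding F

theorem compKappa_apply (F : 𝓢(E4, ℂ)) (x : E4) : compKappa F x = F (kappa x) := rfl

theorem minkFourier_compKappa_tensor (m : ℝ) (f : 𝓢(ℝ, ℂ)) (g : 𝓢(E3, ℂ)) (q : E3) :
    minkFourier (compKappa (tensor f g)) (kappa (lcShell m q)) =
      (∫ s : ℝ, f s * Complex.exp (Complex.I * (s * lcEnergy m q : ℝ))) * lcFourier g q := by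
  rw [minkFourier_apply, lcFourier_apply, ← integral_mul_time_spatial, ← integral_comp_kappa]
  congr 1
  funext y
  rw [compKappa_apply, kappa_kappa, mink_kappa_lcShell, Complex.ofReal_add, mul_add,
    Complex.exp_add]
  change f (time y) * g (spatial y) * _ = _
  ring

/-- Fubini, once the division by $q^-$ is integrable by tameness. No support condition is put on
$f$, so that time correlations of arbitrary Schwartz functions may be inserted later. -/
theorem pauliJordanLC_tensor {m : ℝ} (hm : 0 < m) (f : 𝓢(ℝ, ℂ)) (g : tameSpace (2 : Fin 3)) :
    pauliJordanLC m (tensor f g) = ∫ s : ℝ, lcRestriction m s g * f s := by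
  have hφ := measurable_lcEnergy m
  have hk := integrable_lcFourier_div g.2
  have hprod : Integrable (fun z : E3 × ℝ => (lcFourier g z.1 / (2 * (z.1 2 : ℂ)) * f z.2) *
      Complex.exp (Complex.I * (z.2 * lcEnergy m z.1 : ℝ))) :=
    integrable_mul_cexp (by fun_prop) (hk.mul_prod f.integrable)
  have e : ∀ q : E3, minkFourier (compKappa (tensor f g)) (kappa (lcShell m q)) /
      (2 * (q 2 : ℂ)) = ∫ s : ℝ, (lcFourier g q / (2 * (q 2 : ℂ)) * f s) *
        Complex.exp (Complex.I * (s * lcEnergy m q : ℝ)) := by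
    intro q
    rw [minkFourier_compKappa_tensor, mul_div_assoc, ← integral_mul_const]
    congr 1
    funext s
    ring
  have hint : Integrable (fun q : E3 =>
      minkFourier (compKappa (tensor f g)) (kappa (lcShell m q)) / (2 * (q 2 : ℂ))) := by
    simp only [e]
    exact hprod.integral_prod_left
  have h : pauliJordanLC m (tensor f g) = 1 / (Complex.I * (2 * Real.pi) ^ 3) *
      (deltaShell m 1 (minkFourier (compKappa (tensor f g))) -
        deltaShell m (-1) (minkFourier (compKappa (tensor f g)))) := rfl
  rw [h, deltaShell_sub hm _ hint]
  simp only [e]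
  rw [integral_integral_swap hprod, ← integral_const_mul]
  congr 1
  funext s
  rw [lcRestriction_apply, mul_assoc, ← integral_mul_const]
  congr 2
  funext q
  ring

/-! ### The tame restriction of the Pauli-Jordan function -/

theorem isParameterFamily_lcRestriction {m : ℝ} (hm : 0 < m) :
    IsParameterFamily (relax 3 (pauliJordanLC m)) univ (lcRestriction m) where
  smooth g := (contDiff_lcRestriction m g).contDiffOn
  apply_tensor f _ _ g := by
    rw [setIntegral_univ]
    exact pauliJordanLC_tensor hm f g

theorem IsParameterFamily.mono {u : TameDual (3 : Fin 4)} {Ω Ω' : Set ℝ}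
    {U : ℝ → TameDual (2 : Fin 3)} (h : IsParameterFamily u Ω U) (hΩ : Ω' ⊆ Ω) :
    IsParameterFamily u Ω' U where
  smooth g := (h.smooth g).mono hΩ
  apply_tensor f hf hfs g := by
    rw [h.apply_tensor f hf (hfs.trans hΩ) g,
      ← integral_eq_setIntegral_of_tsupport_subset (hfs.trans hΩ),
      ← integral_eq_setIntegral_of_tsupport_subset hfs]

theorem IsParameterFamily.eqOn {u : TameDual (3 : Fin 4)} {Ω : Set ℝ} (hΩ : IsOpen Ω)
    {U U' : ℝ → TameDual (2 : Fin 3)} (h : IsParameterFamily u Ω U)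
    (h' : IsParameterFamily u Ω U') : EqOn U U' Ω := by
  intro s hs
  ext g
  exact eqOn_of_integral_mul_eq hΩ (h.smooth g).continuousOn (h'.smooth g).continuousOn
    (fun f hf hfs => (h.apply_tensor f hf hfs g).symm.trans (h'.apply_tensor f hf hfs g)) hs

theorem hasTameRestriction_pauliJordanLC_iff {m : ℝ} (hm : 0 < m) (v : TameDual (2 : Fin 3)) :
    HasTameRestriction (pauliJordanLC m) v ↔ v = (1 / 4 : ℂ) • relax 2 deltaSign := by
  constructor
  · rintro ⟨Ω, U, hΩ, h0, hU, rfl⟩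
    rw [← lcRestriction_zero m]
    -- Any competing family on $\Omega$ is compared there with the globally defined one.
    exact hU.eqOn hΩ ((isParameterFamily_lcRestriction hm).mono (subset_univ Ω)) h0
  · rintro rfl
    exact ⟨univ, lcRestriction m, isOpen_univ, mem_univ 0, isParameterFamily_lcRestriction hm,
      lcRestriction_zero m⟩

/-! ### Complex conjugation of test functions -/

/-- The complex conjugate of a Schwartz function on a normed space. -/
def schwartzConj {E : Type*} [NormedAddCommGroup E] [NormedSpace ℝ E] (f : 𝓢(E, ℂ)) : 𝓢(E, ℂ) :=
  f.postcompCLM (Complex.conjCLE : ℂ →L[ℝ] ℂ)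

theorem schwartzConj_apply {E : Type*} [NormedAddCommGroup E] [NormedSpace ℝ E] (f : 𝓢(E, ℂ))
    (x : E) : schwartzConj f x = starRingEnd ℂ (f x) := rfl

theorem schwartzConj_schwartzConj {E : Type*} [NormedAddCommGroup E] [NormedSpace ℝ E]
    (f : 𝓢(E, ℂ)) : schwartzConj (schwartzConj f) = f := by
  ext x
  simp [schwartzConj_apply]

theorem lineDeriv_schwartzConj {E : Type*} [NormedAddCommGroup E] [NormedSpace ℝ E] (v : E)
    (f : 𝓢(E, ℂ)) : ∂_{v} (schwartzConj f) = schwartzConj (∂_{v} f) := by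
  ext x
  rw [SchwartzMap.lineDerivOp_apply_eq_fderiv, schwartzConj_apply,
    SchwartzMap.lineDerivOp_apply_eq_fderiv]
  have h : HasFDerivAt (schwartzConj f)
      ((Complex.conjCLE : ℂ →L[ℝ] ℂ).comp (fderiv ℝ f x)) x :=
    (Complex.conjCLE : ℂ →L[ℝ] ℂ).hasFDerivAt.comp x (f.hasFDerivAt x)
  rw [h.fderiv]
  rfl

theorem schwartzConj_mem {ι : Type} [Fintype ι] [DecidableEq ι] {i : ι}
    {g : 𝓢(EuclideanSpace ℝ ι, ℂ)} (hg : g ∈ tameSpace i) : schwartzConj g ∈ tameSpace i := by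
  rw [mem_tameSpace_iff] at hg ⊢
  intro k
  obtain ⟨G, rfl⟩ := hg k
  exact ⟨schwartzConj G, (Function.Semiconj.iterate_right (f := schwartzConj)
    (fun g' => (lineDeriv_schwartzConj _ g').symm) k G).symm⟩

/-- The complex conjugate of a tame test function. -/
def tameConj {ι : Type} [Fintype ι] [DecidableEq ι] {i : ι} (g : tameSpace i) : tameSpace i :=
  ⟨schwartzConj g, schwartzConj_mem g.2⟩

theorem tameConj_tameConj {ι : Type} [Fintype ι] [DecidableEq ι] {i : ι} (g : tameSpace i) :
    tameConj (tameConj g) = g :=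
  Subtype.ext (schwartzConj_schwartzConj _)

theorem conjSchwartz_compKappa_tensor (f : 𝓢(ℝ, ℂ)) (g : 𝓢(E3, ℂ)) :
    conjSchwartz (compKappa (tensor f g)) =
      compKappa (tensor (schwartzConj f) (schwartzConj g)) := by
  ext x
  exact map_mul (starRingEnd ℂ) _ _

theorem hasCompactSupport_schwartzConj {f : 𝓢(ℝ, ℂ)} (hf : HasCompactSupport f) :
    HasCompactSupport (schwartzConj f) :=
  HasCompactSupport.comp_left (g := starRingEnd ℂ) hf (map_zero _)

theorem tsupport_schwartzConj_subset (f : 𝓢(ℝ, ℂ)) : tsupport (schwartzConj f) ⊆ tsupport f :=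
  closure_mono (Function.support_comp_subset (map_zero (starRingEnd ℂ)) f)

/-! ### Correlation of test functions -/

section Correlation

variable {E : Type*} [NormedAddCommGroup E] [InnerProductSpace ℝ E] [FiniteDimensional ℝ E]
  [MeasurableSpace E] [BorelSpace E]

/-- The Schwartz function `x ↦ ∫ f(y) g(y - x) dy`. -/
def correlation (f g : 𝓢(E, ℂ)) : 𝓢(E, ℂ) :=
  SchwartzMap.convolution (ContinuousLinearMap.mul ℂ ℂ) f
    (SchwartzMap.compCLMOfContinuousLinearEquiv ℂ (ContinuousLinearEquiv.neg ℝ) g)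

theorem correlation_apply (f g : 𝓢(E, ℂ)) (x : E) :
    correlation f g x = ∫ y, f y * g (y - x) := by
  rw [correlation, SchwartzMap.convolution_apply, convolution_def]
  congr 1
  funext y
  simp

/-- On the Fourier side correlation is a product and the derivative a multiplier, which can be
attached to the first factor. -/
theorem lineDeriv_correlation (v : E) (f g : 𝓢(E, ℂ)) :
    ∂_{v} (correlation f g) = correlation (∂_{v} f) g := by
  have hv : (inner ℝ · v).HasTemperateGrowth := ((innerSL ℝ).flip v).hasTemperateGrowth
  have h : 𝓕 (∂_{v} (correlation f g)) = 𝓕 (correlation (∂_{v} f) g) := by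
    ext x
    rw [SchwartzMap.fourier_lineDerivOp_eq, correlation, correlation,
      SchwartzMap.fourier_convolution, SchwartzMap.fourier_convolution,
      SchwartzMap.fourier_lineDerivOp_eq]
    simp [SchwartzMap.smulLeftCLM_apply_apply hv, SchwartzMap.pairing_apply_apply, mul_assoc]
  have := congrArg (𝓕⁻ : 𝓢(E, ℂ) → 𝓢(E, ℂ)) h
  simpa using this

end Correlation

theorem differencePairing_eq {ι : Type} [Fintype ι] (T : 𝓢'(EuclideanSpace ℝ ι, ℂ))
    (f g : 𝓢(EuclideanSpace ℝ ι, ℂ)) : differencePairing T f g = T (correlation f g) := rfl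

/-- Each primitive in the $x^-$ direction is obtained by correlating a primitive of $f$ with $g$. -/
theorem correlation_mem {ι : Type} [Fintype ι] [DecidableEq ι] {i : ι}
    {f : 𝓢(EuclideanSpace ℝ ι, ℂ)} (hf : f ∈ tameSpace i) (g : 𝓢(EuclideanSpace ℝ ι, ℂ)) :
    correlation f g ∈ tameSpace i := by
  rw [mem_tameSpace_iff] at hf ⊢
  intro k
  obtain ⟨F, rfl⟩ := hf k
  exact ⟨correlation F g, (Function.Semiconj.iterate_right (f := fun F => correlation F g)
    (fun F' => (lineDeriv_correlation _ F' g).symm) k F).symm⟩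

/-- $\kappa$ is a linear, measure-preserving involution, so it commutes with correlation; the
integral then factors into time and space. -/
theorem correlation_compKappa_tensor (f₁ f₂ : 𝓢(ℝ, ℂ)) (g₁ g₂ : 𝓢(E3, ℂ)) :
    correlation (compKappa (tensor f₁ g₁)) (compKappa (tensor f₂ g₂)) =
      compKappa (tensor (correlation f₁ f₂) (correlation g₁ g₂)) := by
  ext x
  have h : compKappa (tensor (correlation f₁ f₂) (correlation g₁ g₂)) x =
      correlation f₁ f₂ (time (kappa x)) * correlation g₁ g₂ (spatial (kappa x)) := rfl
  rw [h, correlation_apply, correlation_apply, correlation_apply, ← integral_mul_time_spatial,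
    ← integral_comp_kappa]
  congr 1
  funext y
  rw [compKappa_apply, compKappa_apply, map_sub, kappa_kappa, ← map_sub, ← map_sub]
  change f₁ (time y) * g₁ (spatial y) *
    (f₂ (time (y - kappa x)) * g₂ (spatial (y - kappa x))) = _
  ring

/-! ### The smeared commutator function -/

/-- The bound is uniform in $s$: it provides the domination and the Fubini hypothesis for the
time-smeared commutator function. -/
theorem norm_lcRestriction_le (m s : ℝ) (g : tameSpace (2 : Fin 3)) :
    ‖lcRestriction m s g‖ ≤ ‖(1 / (Complex.I * (2 * Real.pi) ^ 3) : ℂ)‖ *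
      ∫ q : E3, ‖lcFourier g q / (2 * (q 2 : ℂ))‖ := by
  rw [lcRestriction_apply, norm_mul]
  gcongr
  refine (norm_integral_le_integral_norm _).trans_eq ?_
  simp only [norm_mul, norm_cexp_I_mul_ofReal, mul_one]

theorem continuous_lcRestriction (m : ℝ) (g : tameSpace (2 : Fin 3)) :
    Continuous (fun s => lcRestriction m s g) :=
  (contDiff_lcRestriction m g).continuous

theorem continuous_integral_lcRestriction_sub (m : ℝ) (g : tameSpace (2 : Fin 3)) (h : 𝓢(ℝ, ℂ)) :
    Continuous (fun t => ∫ r : ℝ, lcRestriction m (t - r) g * h r) := by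
  have hc := continuous_lcRestriction m g
  refine continuous_of_dominated (bound := fun r => ‖(1 / (Complex.I * (2 * Real.pi) ^ 3) : ℂ)‖ *
      (∫ q : E3, ‖lcFourier g q / (2 * (q 2 : ℂ))‖) * ‖h r‖) (fun t => ?_) (fun t => ?_) ?_ ?_
  · have := h.continuous
    exact Continuous.aestronglyMeasurable (by fun_prop)
  · refine Filter.Eventually.of_forall fun r => ?_
    rw [norm_mul]
    gcongr
    exact norm_lcRestriction_le m _ g
  · exact h.integrable.norm.const_mul _
  · refine Filter.Eventually.of_forall fun r => ?_
    fun_prop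

theorem integral_lcRestriction_mul_correlation (m : ℝ) (g : tameSpace (2 : Fin 3))
    (f h : 𝓢(ℝ, ℂ)) :
    ∫ s : ℝ, lcRestriction m s g * correlation f h s =
      ∫ t : ℝ, (∫ r : ℝ, lcRestriction m (t - r) g * h r) * f t := by
  have hneg : Integrable (fun r => h (-r)) := h.integrable.comp_neg
  have h1 := (f.integrable (μ := volume)).convolution_integrand (ContinuousLinearMap.mul ℂ ℂ) hneg
  have hU := continuous_lcRestriction m g
  have h2 : Integrable (fun p : ℝ × ℝ =>
      lcRestriction m p.1 g * (f p.2 * h (p.2 - p.1))) (volume.prod volume) := by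
    refine (h1.bdd_mul (c := ‖(1 / (Complex.I * (2 * Real.pi) ^ 3) : ℂ)‖ *
      ∫ q : E3, ‖lcFourier g q / (2 * (q 2 : ℂ))‖)
      (f := fun p : ℝ × ℝ => lcRestriction m p.1 g) ?_ ?_).congr ?_
    · exact (hU.comp continuous_fst).aestronglyMeasurable
    · exact Filter.Eventually.of_forall fun p => norm_lcRestriction_le m _ g
    · refine Filter.Eventually.of_forall fun p => ?_
      simp
  simp only [correlation_apply, ← integral_const_mul]
  rw [integral_integral_swap h2]
  congr 1
  funext t
  -- The substitution $r=t-s$ turns $h(t-s)$ into $h(r)$.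
  rw [← integral_mul_const, ← integral_sub_left_eq_self _ volume t]
  congr 1
  funext r
  rw [sub_sub_cancel]
  ring

theorem differencePairing_pauliJordan {m : ℝ} (hm : 0 < m) (f h : 𝓢(ℝ, ℂ))
    (g₁ g₂ : tameSpace (2 : Fin 3)) :
    differencePairing (pauliJordan m) (compKappa (tensor f g₁)) (compKappa (tensor h g₂)) =
      ∫ t : ℝ, (∫ r : ℝ, lcRestriction m (t - r)
        ⟨correlation g₁ g₂, correlation_mem g₁.2 g₂⟩ * h r) * f t := by
  rw [differencePairing_eq, correlation_compKappa_tensor, ← integral_lcRestriction_mul_correlation]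
  exact pauliJordanLC_tensor hm (correlation f h) ⟨correlation g₁ g₂, correlation_mem g₁.2 g₂⟩

/-! ### Restrictions of fields -/

section Field

variable {V : Type*} [NormedAddCommGroup V] [InnerProductSpace ℂ V]

/-- The matrix elements of `Φ_s`, `s ∈ Ω`, are continuous in `s` and integrate to those of `Φ`. -/
structure IsFieldFamily (Φ : 𝓢(E4, ℂ) →ₗ[ℂ] Module.End ℂ V) (Ω : Set ℝ)
    (Φs : ℝ → tameSpace (2 : Fin 3) →ₗ[ℂ] Module.End ℂ V) : Prop where
  isOpen : IsOpen Ω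
  continuousOn : ∀ (ψ χ : V) (g : tameSpace (2 : Fin 3)),
    ContinuousOn (fun s => inner ℂ ψ (Φs s g χ)) Ω
  inner_tensor : ∀ (ψ χ : V) (f : 𝓢(ℝ, ℂ)), HasCompactSupport f → tsupport f ⊆ Ω →
    ∀ g : tameSpace (2 : Fin 3),
      inner ℂ ψ (Φ (tensor f g) χ) = ∫ s in Ω, inner ℂ ψ (Φs s g χ) * f s

theorem HasTameFieldRestriction.exists_isFieldFamily {Φ : 𝓢(E4, ℂ) →ₗ[ℂ] Module.End ℂ V}
    {Φ₀ : tameSpace (2 : Fin 3) →ₗ[ℂ] Module.End ℂ V} (h : HasTameFieldRestriction Φ Φ₀) :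
    ∃ (Ω : Set ℝ) (Φs : ℝ → tameSpace (2 : Fin 3) →ₗ[ℂ] Module.End ℂ V),
      0 ∈ Ω ∧ Φs 0 = Φ₀ ∧ IsFieldFamily Φ Ω Φs := by
  obtain ⟨Ω, Φs, hΩ, h0, hΦ₀, hΦ⟩ := h
  refine ⟨Ω, Φs, h0, hΦ₀, hΩ, fun ψ χ g => ?_, fun ψ χ f hf hfs g => ?_⟩
  · obtain ⟨u, U, _, hU, hfam⟩ := hΦ ψ χ
    exact (hfam.smooth g).continuousOn.congr fun s hs => (hU s hs g).symm
  · obtain ⟨u, U, hu, hU, hfam⟩ := hΦ ψ χ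
    rw [← hu]
    refine (hfam.apply_tensor f hf hfs g).trans ?_
    exact setIntegral_congr_fun hΩ.measurableSet fun s hs => by simp only [hU s hs g]

variable {m : ℝ} {φ : 𝓢(E4, ℂ) →ₗ[ℂ] Module.End ℂ V} {Ω : Set ℝ}
  {Φs : ℝ → tameSpace (2 : Fin 3) →ₗ[ℂ] Module.End ℂ V}

theorem IsFreeField.inner_fieldLC_tensor (hφ : IsFreeField m φ) (f : 𝓢(ℝ, ℂ)) (g : 𝓢(E3, ℂ))
    (ψ χ : V) : inner ℂ (fieldLC φ (tensor f g) ψ) χ =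
      inner ℂ ψ (fieldLC φ (tensor (schwartzConj f) (schwartzConj g)) χ) := by
  have := hφ.hermitian (compKappa (tensor f g)) ψ χ
  rwa [conjSchwartz_compKappa_tensor] at this

/-- Hermiticity of the restricted field is not assumed: both sides are continuous in $s$ and have
equal integrals against every test function, by hermiticity of $\phi$ applied to the conjugate test
function. -/
theorem IsFieldFamily.hermitian (hΦ : IsFieldFamily (fieldLC φ) Ω Φs) (hφ : IsFreeField m φ)
    {s : ℝ} (hs : s ∈ Ω) (g : tameSpace (2 : Fin 3)) (ψ χ : V) :
    inner ℂ (Φs s g ψ) χ = inner ℂ ψ (Φs s (tameConj g) χ) := by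
  have hc : ∀ s, inner ℂ (Φs s g ψ) χ = starRingEnd ℂ (inner ℂ χ (Φs s g ψ)) := fun s =>
    (inner_conj_symm _ _).symm
  refine eqOn_of_integral_mul_eq hΦ.isOpen (a := fun s => inner ℂ (Φs s g ψ) χ)
    (b := fun s => inner ℂ ψ (Φs s (tameConj g) χ)) ?_ (hΦ.continuousOn ψ χ _) ?_ hs
  · simp only [hc]
    exact Complex.continuous_conj.comp_continuousOn (hΦ.continuousOn χ ψ g)
  · intro f hf hfs
    have h1 := hΦ.inner_tensor χ ψ (schwartzConj f) (hasCompactSupport_schwartzConj hf)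
      ((tsupport_schwartzConj_subset f).trans hfs) g
    have h2 := hφ.inner_fieldLC_tensor (schwartzConj f) g ψ χ
    rw [schwartzConj_schwartzConj, ← inner_conj_symm, h1, ← integral_conj] at h2
    have h3 := hΦ.inner_tensor ψ χ f hf hfs (tameConj g)
    rw [← h3]
    refine Eq.trans ?_ h2
    congr 1
    funext s
    rw [hc, map_mul, schwartzConj_apply, Complex.conj_conj]

theorem IsFieldFamily.hermitian' (hΦ : IsFieldFamily (fieldLC φ) Ω Φs) (hφ : IsFreeField m φ)
    {s : ℝ} (hs : s ∈ Ω) (g : tameSpace (2 : Fin 3)) (ψ χ : V) :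
    inner ℂ ψ (Φs s g χ) = inner ℂ (Φs s (tameConj g) ψ) χ := by
  rw [hΦ.hermitian hφ hs, tameConj_tameConj]

theorem IsFreeField.inner_commutator (hm : 0 < m) (hφ : IsFreeField m φ) (f h : 𝓢(ℝ, ℂ))
    (g₁ g₂ : tameSpace (2 : Fin 3)) (ψ χ : V) :
    inner ℂ ψ (fieldLC φ (tensor f g₁) (fieldLC φ (tensor h g₂) χ)) -
        inner ℂ ψ (fieldLC φ (tensor h g₂) (fieldLC φ (tensor f g₁) χ)) =
      ∫ t : ℝ, (-Complex.I * inner ℂ ψ χ * ∫ r : ℝ, lcRestriction m (t - r)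
        ⟨correlation g₁ g₂, correlation_mem g₁.2 g₂⟩ * h r) * f t := by
  have h1 := congrArg (fun A : Module.End ℂ V => inner ℂ ψ (A χ))
    (hφ.commutator (compKappa (tensor f g₁)) (compKappa (tensor h g₂)))
  rw [differencePairing_pauliJordan hm] at h1
  simp only [LinearMap.sub_apply, Module.End.mul_apply, inner_sub_right, LinearMap.smul_apply,
    Module.End.one_apply, inner_smul_right] at h1
  refine h1.trans ?_
  rw [mul_right_comm, ← integral_const_mul]
  congr 1
  funext t
  ring

/-- Removes the first time smearing only. The field smeared with $h\otimes g_2$ is absorbed into the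
ket in one term and, by hermiticity, into the bra in the other, so that each term is a matrix
element of a single restricted field. -/
theorem IsFieldFamily.inner_commutator_field (hm : 0 < m)
    (hΦ : IsFieldFamily (fieldLC φ) Ω Φs) (hφ : IsFreeField m φ) {s : ℝ} (hs : s ∈ Ω)
    (h : 𝓢(ℝ, ℂ)) (g₁ g₂ : tameSpace (2 : Fin 3)) (ψ χ : V) :
    inner ℂ ψ (Φs s g₁ (fieldLC φ (tensor h g₂) χ)) -
        inner ℂ ψ (fieldLC φ (tensor h g₂) (Φs s g₁ χ)) =
      -Complex.I * inner ℂ ψ χ * ∫ r : ℝ, lcRestriction m (s - r)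
        ⟨correlation g₁ g₂, correlation_mem g₁.2 g₂⟩ * h r := by
  have hsw : ∀ χ' : V, inner ℂ ψ (fieldLC φ (tensor h g₂) χ') =
      inner ℂ (fieldLC φ (tensor (schwartzConj h) (schwartzConj g₂)) ψ) χ' := fun χ' => by
    rw [hφ.inner_fieldLC_tensor, schwartzConj_schwartzConj, schwartzConj_schwartzConj]
  set ψ' := fieldLC φ (tensor (schwartzConj h) (schwartzConj g₂)) ψ
  have ha := hΦ.continuousOn ψ (fieldLC φ (tensor h g₂) χ) g₁
  have hb := hΦ.continuousOn ψ' χ g₁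
  have key := eqOn_of_integral_mul_eq hΦ.isOpen (ha.sub hb)
    (continuous_const.mul (continuous_integral_lcRestriction_sub m
      ⟨correlation g₁ g₂, correlation_mem g₁.2 g₂⟩ h)).continuousOn
    (a := fun s => inner ℂ ψ (Φs s g₁ (fieldLC φ (tensor h g₂) χ)) - inner ℂ ψ' (Φs s g₁ χ))
    (b := fun s => -Complex.I * inner ℂ ψ χ * ∫ r : ℝ, lcRestriction m (s - r)
        ⟨correlation g₁ g₂, correlation_mem g₁.2 g₂⟩ * h r) (fun f hf hfs => ?_) hs
  · rw [hsw]
    exact key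
  · rw [← integral_eq_setIntegral_of_tsupport_subset hfs,
      ← integral_eq_setIntegral_of_tsupport_subset hfs, ← hφ.inner_commutator hm, hsw,
      hΦ.inner_tensor _ _ f hf hfs, hΦ.inner_tensor _ _ f hf hfs,
      ← integral_sub (integrableOn_mul_of_tsupport_subset hf hfs ha)
        (integrableOn_mul_of_tsupport_subset hf hfs hb),
      integral_eq_setIntegral_of_tsupport_subset hfs]
    simp only [sub_mul]

/-- Removes the second smearing with $s$ fixed. Now the operator at time $s$ is absorbed into bra or
ket, which uses hermiticity of the restricted field. -/
theorem IsFieldFamily.inner_commutator (hm : 0 < m)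
    (hΦ : IsFieldFamily (fieldLC φ) Ω Φs) (hφ : IsFreeField m φ) {s t : ℝ} (hs : s ∈ Ω)
    (ht : t ∈ Ω) (g₁ g₂ : tameSpace (2 : Fin 3)) (ψ χ : V) :
    inner ℂ ψ (Φs s g₁ (Φs t g₂ χ)) - inner ℂ ψ (Φs t g₂ (Φs s g₁ χ)) =
      -Complex.I * inner ℂ ψ χ * lcRestriction m (s - t)
        ⟨correlation g₁ g₂, correlation_mem g₁.2 g₂⟩ := by
  have ha := hΦ.continuousOn (Φs s (tameConj g₁) ψ) χ g₂
  have hb := hΦ.continuousOn ψ (Φs s g₁ χ) g₂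
  have key := eqOn_of_integral_mul_eq hΦ.isOpen (ha.sub hb)
    (continuous_const.mul ((continuous_lcRestriction m
      ⟨correlation g₁ g₂, correlation_mem g₁.2 g₂⟩).comp
        (continuous_const.sub continuous_id))).continuousOn
    (a := fun t => inner ℂ (Φs s (tameConj g₁) ψ) (Φs t g₂ χ) - inner ℂ ψ (Φs t g₂ (Φs s g₁ χ)))
    (b := fun t => -Complex.I * inner ℂ ψ χ * lcRestriction m (s - t)
        ⟨correlation g₁ g₂, correlation_mem g₁.2 g₂⟩) (fun h hc hcs => ?_) ht
  · rw [hΦ.hermitian' hφ hs]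
    exact key
  · have h1 := hΦ.inner_commutator_field hm hφ hs h g₁ g₂ ψ χ
    rw [hΦ.hermitian' hφ hs, hΦ.inner_tensor _ _ h hc hcs, hΦ.inner_tensor _ _ h hc hcs,
      ← integral_sub (integrableOn_mul_of_tsupport_subset hc hcs ha)
        (integrableOn_mul_of_tsupport_subset hc hcs hb), ← integral_const_mul] at h1
    rw [← integral_eq_setIntegral_of_tsupport_subset hcs fun t => -Complex.I * inner ℂ ψ χ *
      lcRestriction m (s - t) ⟨correlation g₁ g₂, correlation_mem g₁.2 g₂⟩]
    simp only [sub_mul, mul_assoc] at h1 ⊢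
    exact h1

theorem commutator_of_hasTameFieldRestriction (hm : 0 < m) (hφ : IsFreeField m φ)
    {φ₀ : tameSpace (2 : Fin 3) →ₗ[ℂ] Module.End ℂ V}
    (h : HasTameFieldRestriction (fieldLC φ) φ₀) (g₁ g₂ : tameSpace (2 : Fin 3)) :
    φ₀ g₁ * φ₀ g₂ - φ₀ g₂ * φ₀ g₁ =
      (1 / (4 * Complex.I) * differencePairing deltaSign g₁ g₂) • (1 : Module.End ℂ V) := by
  obtain ⟨Ω, Φs, h0, rfl, hΦ⟩ := h.exists_isFieldFamily
  ext χ
  refine ext_inner_left ℂ fun ψ => ?_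
  have key := hΦ.inner_commutator hm hφ h0 h0 g₁ g₂ ψ χ
  rw [sub_zero, lcRestriction_zero] at key
  have hd : ((1 / 4 : ℂ) • relax 2 deltaSign) ⟨correlation g₁ g₂, correlation_mem g₁.2 g₂⟩ =
      1 / 4 * differencePairing deltaSign g₁ g₂ := rfl
  rw [hd] at key
  simp only [LinearMap.sub_apply, Module.End.mul_apply, inner_sub_right, LinearMap.smul_apply,
    Module.End.one_apply, inner_smul_right]
  -- The factor $-i$ of the commutator relation times the $\frac14$ of the restriction.
  have hI : 1 / (4 * Complex.I) = -Complex.I / 4 := by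
    rw [one_div, mul_inv, Complex.inv_I]
    ring
  rw [key, hI]
  ring

end Field

end LightCone

end

theorem mainTheorem10 (m : ℝ) (hm : 0 < m) :
    (∀ v : LightCone.TameDual (2 : Fin 3),
      LightCone.HasTameRestriction (LightCone.pauliJordanLC m) v ↔
        v = (1 / 4 : ℂ) • LightCone.relax 2 LightCone.deltaSign) ∧
    (∀ (V : Type*) [NormedAddCommGroup V] [InnerProductSpace ℂ V]
      (φ : 𝓢(LightCone.E4, ℂ) →ₗ[ℂ] Module.End ℂ V)
      (φ₀ : LightCone.tameSpace (2 : Fin 3) →ₗ[ℂ] Module.End ℂ V),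
      LightCone.IsFreeField m φ →
      LightCone.HasTameFieldRestriction (LightCone.fieldLC φ) φ₀ →
      ∀ g₁ g₂ : LightCone.tameSpace (2 : Fin 3),
        φ₀ g₁ * φ₀ g₂ - φ₀ g₂ * φ₀ g₁ =
          (1 / (4 * Complex.I) * LightCone.differencePairing LightCone.deltaSign g₁ g₂) •
            (1 : Module.End ℂ V)) :=
  ⟨LightCone.hasTameRestriction_pauliJordanLC_iff hm, fun _ _ _ _ _ hφ h =>
    LightCone.commutator_of_hasTameFieldRestriction hm hφ h⟩
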